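/- For $0\le x<1$ let $K(x)=\frac{\pi}{2}\,{}_2F_1\left(\frac12,\frac12;1;x^2\right)$ be the complete elliptic integral of the first kind. Let $r>0$ and $q=e^{-\pi\sqrt r}$. Let $k_r\in(0,1)$ be the unique real solution $x$ of $K(\sqrt{1-x^2})/K(x)=\sqrt r$, and put $k'_r=\sqrt{1-k_r^2}$ and $K=K(k_r)$. For real $u$ define $$\mathrm{cd}_1(q,u)=\frac{2\pi}{Kk_r}\sum_{n=0}^{\infty}\frac{(-1)^n q^{n+1/2}\cos\left((2n+3)\frac{\pi}{2K}u\right)}{1-q^{2n+1}}.$$ For integers $n\ge1$ let $\chi(n)=\left(\frac{n+2}{8}\right)$ be the Kronecker symbol (the Jacobi symbol extended to even moduli), i.e. $\chi(n)=0$ if $n$ is even, $\chi(n)=1$ if $n+2\equiv\pm1\pmod 8$, and $\chi(n)=-1$ if $n+2\equiv\pm3\pmod 8$. Then the series below, and the series defining $\mathrm{cd}_1(q,K/2)$, converge absolutely, and $$\mathrm{cd}_1\left(q,\frac K2\right)=\frac{1}{\sqrt{1+k'_r}}-\frac{\pi\sqrt8}{Kk_r}\sum_{n\ge0,\ n\equiv1\,(4)}\frac{(-1)^{\frac{n-1}{4}}q^{n/2}}{1-q^n}$$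 and $$-\sum_{n=1}^{\infty}\chi(n)\frac{q^{n/2}}{1-q^n}=\frac{Kk_r}{\sqrt2\,\pi\sqrt{1+k'_r}}.$$ -/

import Mathlib

/-- The complete elliptic integral of the first kind, as a function of the modulus `x`:
`K(x) = (π/2) ₂F₁(1/2, 1/2; 1; x²)`. -/
noncomputable def ellipticK (x : ℝ) : ℝ :=
  Real.pi / 2 * ordinaryHypergeometric (1 / 2 : ℝ) (1 / 2 : ℝ) (1 : ℝ) (x ^ 2)

/-- The complementary modulus `k' = √(1 - k²)`. -/
noncomputable def complementaryModulus (k : ℝ) : ℝ := Real.sqrt (1 - k ^ 2)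

/-- `k` is a real solution in `(0, 1)` of `K(√(1 - k²)) / K(k) = √r`. -/
def IsSingularModulus (r k : ℝ) : Prop :=
  0 < k ∧ k < 1 ∧ ellipticK (complementaryModulus k) / ellipticK k = Real.sqrt r

namespace EllipticAux

/-- The coefficients of the power series `₂F₁(1/2, 1/2; 1; t)`. -/
noncomputable def coeff (n : ℕ) : ℝ :=
  ordinaryHypergeometricCoefficient (1 / 2 : ℝ) (1 / 2 : ℝ) (1 : ℝ) n

theorem coeff_pos (n : ℕ) : 0 < coeff n := by
  have h1 : 0 < (ascPochhammer ℝ n).eval (1 / 2 : ℝ) := ascPochhammer_pos n _ (by norm_num)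
  have h2 : 0 < (ascPochhammer ℝ n).eval (1 : ℝ) := ascPochhammer_pos n _ (by norm_num)
  unfold coeff ordinaryHypergeometricCoefficient
  positivity

theorem coeff_succ (n : ℕ) :
    coeff (n + 1) = coeff n * (((n : ℝ) + 1 / 2) / ((n : ℝ) + 1)) ^ 2 := by
  have h2 : (ascPochhammer ℝ n).eval (1 : ℝ) ≠ 0 := (ascPochhammer_pos n _ (by norm_num)).ne'
  have h3 : ((n : ℝ) + 1) ≠ 0 := by positivity
  unfold coeff ordinaryHypergeometricCoefficient
  simp only [Nat.factorial_succ, ascPochhammer_succ_eval, Nat.cast_mul, Nat.cast_add,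
    Nat.cast_one]
  have h4 : (1 + (n : ℝ)) ≠ 0 := by positivity
  have h5 : (Nat.factorial n : ℝ) ≠ 0 := by positivity
  rw [mul_inv, mul_inv, div_pow]
  rw [add_comm (1 : ℝ) (n : ℝ), add_comm (1 / 2 : ℝ) (n : ℝ)]
  field_simp

theorem coeff_lower (n : ℕ) : 1 / 4 * (1 / ((n : ℝ) + 1)) ≤ coeff (n + 1) := by
  induction n with
  | zero =>
    rw [coeff_succ]
    simp [coeff, ordinaryHypergeometricCoefficient]
    norm_num
  | succ n ih =>
    rw [coeff_succ]
    refine le_trans ?_ (mul_le_mul_of_nonneg_right ih (by positivity))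
    push_cast
    rw [div_pow, ← sub_nonneg]
    have : 1 / 4 * (1 / ((n : ℝ) + 1)) * ((((n : ℝ) + 1 + 1 / 2) ^ 2) / ((n : ℝ) + 1 + 1) ^ 2)
        - 1 / 4 * (1 / ((n : ℝ) + 1 + 1))
        = 1 / (16 * ((n : ℝ) + 1) * ((n : ℝ) + 1 + 1) ^ 2) := by
      field_simp
      ring
    rw [this]
    positivity

/-- The function `₂F₁(1/2, 1/2; 1; t)`. -/
noncomputable def F (t : ℝ) : ℝ :=
  ordinaryHypergeometric (1 / 2 : ℝ) (1 / 2 : ℝ) (1 : ℝ) t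

theorem radius_eq :
    (ordinaryHypergeometricSeries ℝ (1 / 2 : ℝ) (1 / 2 : ℝ) (1 : ℝ)).radius = 1 := by
  apply ordinaryHypergeometricSeries_radius_eq_one
  intro n
  have : (0 : ℝ) ≤ n := Nat.cast_nonneg n
  refine ⟨?_, ?_, ?_⟩ <;> intro h <;> linarith

theorem hasSum_F {t : ℝ} (h0 : 0 ≤ t) (h1 : t < 1) : HasSum (fun n => coeff n * t ^ n) (F t) := by
  have ht : t ∈ Metric.eball (0 : ℝ)
      (ordinaryHypergeometricSeries ℝ (1 / 2 : ℝ) (1 / 2 : ℝ) (1 : ℝ)).radius := by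
    rw [radius_eq, ← ENNReal.ofReal_one, Metric.eball_ofReal]
    simpa [abs_of_nonneg h0] using h1
  have := FormalMultilinearSeries.hasSum _ ht
  rw [ordinaryHypergeometricSeries_apply_eq'] at this
  exact this

theorem continuousOn_F : ContinuousOn F (Set.Ico 0 1) := by
  have h := (FormalMultilinearSeries.hasFPowerSeriesOnBall
    (ordinaryHypergeometricSeries ℝ (1 / 2 : ℝ) (1 / 2 : ℝ) (1 : ℝ))
    (by rw [radius_eq]; exact one_pos)).continuousOn
  refine ContinuousOn.mono h ?_
  intro t ht
  rw [radius_eq, ← ENNReal.ofReal_one, Metric.eball_ofReal]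
  simpa [abs_of_nonneg ht.1] using ht.2

theorem one_le_F {t : ℝ} (h0 : 0 ≤ t) (h1 : t < 1) : 1 ≤ F t := by
  have h := sum_le_hasSum {0} (fun n _ => mul_nonneg (coeff_pos n).le (pow_nonneg h0 n))
    (hasSum_F h0 h1)
  simpa [coeff, ordinaryHypergeometricCoefficient] using h

theorem F_strictMono {s t : ℝ} (h0 : 0 ≤ s) (hst : s < t) (h1 : t < 1) : F s < F t := by
  refine hasSum_lt (i := 1) (fun n => ?_) ?_ (hasSum_F h0 (hst.trans h1))
    (hasSum_F (h0.trans hst.le) h1)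
  · exact mul_le_mul_of_nonneg_left (pow_le_pow_left₀ h0 hst.le n) (coeff_pos n).le
  · simpa using mul_lt_mul_of_pos_left hst (coeff_pos 1)

theorem F_unbounded (M : ℝ) : ∃ δ : ℝ, δ < 1 ∧ ∀ t, δ < t → 0 ≤ t → t < 1 → M < F t := by
  have hdiv : Filter.Tendsto (fun N => ∑ n ∈ Finset.range N, coeff n) Filter.atTop
      Filter.atTop := by
    have hns : ¬ Summable coeff := by
      intro h
      have h' := (summable_nat_add_iff 1).2 h
      have h2 : Summable fun n : ℕ => 1 / 4 * (1 / ((n : ℝ) + 1)) :=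
        Summable.of_nonneg_of_le (fun n => by positivity) coeff_lower h'
      have h3 := (summable_mul_left_iff (by norm_num : (1 / 4 : ℝ) ≠ 0)).1 h2
      have h4 : Summable fun n : ℕ => 1 / (n : ℝ) := by
        refine (summable_nat_add_iff 1).1 ?_
        simpa using h3
      exact Real.not_summable_one_div_natCast h4
    exact (not_summable_iff_tendsto_nat_atTop_of_nonneg fun n => (coeff_pos n).le).1 hns
  obtain ⟨N, hN⟩ := (hdiv.eventually_gt_atTop M).exists
  have hc : Continuous fun t : ℝ => ∑ n ∈ Finset.range N, coeff n * t ^ n := by fun_prop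
  have hev : ∀ᶠ t in nhds (1 : ℝ), M < ∑ n ∈ Finset.range N, coeff n * t ^ n := by
    refine hc.continuousAt.eventually (lt_mem_nhds ?_)
    simpa using hN
  obtain ⟨ε, hε, h⟩ := Metric.eventually_nhds_iff.1 hev
  refine ⟨1 - ε, by linarith, fun t ht h0 h1 => ?_⟩
  refine lt_of_lt_of_le (h ?_) (sum_le_hasSum (Finset.range N)
    (fun n _ => mul_nonneg (coeff_pos n).le (pow_nonneg h0 n)) (hasSum_F h0 h1))
  rw [Real.dist_eq, abs_lt]
  constructor <;> linarith

theorem ratio_eq {k : ℝ} (h0 : 0 ≤ k) (h1 : k ≤ 1) :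
    ellipticK (complementaryModulus k) / ellipticK k = F (1 - k ^ 2) / F (k ^ 2) := by
  have h : (0 : ℝ) ≤ 1 - k ^ 2 := by nlinarith
  unfold ellipticK complementaryModulus
  rw [Real.sq_sqrt h]
  exact mul_div_mul_left _ _ (by positivity)

theorem ratio_anti {x y : ℝ} (h0 : 0 < x) (hxy : x < y) (h1 : y < 1) :
    F (1 - y) / F y < F (1 - x) / F x := by
  have hx := one_le_F h0.le (hxy.trans h1)
  have hy := one_le_F (h0.trans hxy).le h1
  have hx' := one_le_F (t := 1 - x) (by linarith) (by linarith)
  have a := F_strictMono h0.le hxy h1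
  have b := F_strictMono (s := 1 - y) (t := 1 - x) (by linarith) (by linarith) (by linarith)
  rw [div_lt_div_iff₀ (by linarith) (by linarith)]
  have hy' := one_le_F (t := 1 - y) (by linarith) (by linarith)
  nlinarith

theorem exists_ratio {s : ℝ} (hs : 0 < s) : ∃ x, 0 < x ∧ x < 1 ∧ F (1 - x) / F x = s := by
  obtain ⟨δ, hδ, h⟩ := F_unbounded ((s + 1 / s) * F (1 / 2))
  obtain ⟨a, ha⟩ : ∃ a : ℝ, a = min (1 / 2) ((1 - δ) / 2) := ⟨_, rfl⟩
  have ha0 : 0 < a := by rw [ha]; exact lt_min (by norm_num) (by linarith)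
  have ha1 : a ≤ 1 / 2 := by rw [ha]; exact min_le_left _ _
  have ha2 : a ≤ (1 - δ) / 2 := by rw [ha]; exact min_le_right _ _
  have hb := h (1 - a) (by linarith) (by linarith) (by linarith)
  have hF : F a ≤ F (1 / 2) := by
    rcases ha1.lt_or_eq with h' | h'
    · exact (F_strictMono ha0.le h' (by norm_num)).le
    · rw [h']
  have hFa := one_le_F ha0.le (by linarith : a < 1)
  have hFb := one_le_F (t := 1 - a) (by linarith) (by linarith)
  have hs' : 0 < 1 / s := by positivity
  have key : (s + 1 / s) * F a < F (1 - a) :=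
    lt_of_le_of_lt (mul_le_mul_of_nonneg_left hF (by positivity)) hb
  have hcont : ContinuousOn (fun x => F (1 - x) / F x) (Set.Icc a (1 - a)) := by
    refine ContinuousOn.div ?_ ?_ ?_
    · refine continuousOn_F.comp (by fun_prop) ?_
      intro x hx
      exact ⟨by linarith [hx.2], by linarith [hx.1]⟩
    · exact continuousOn_F.mono fun x hx => ⟨by linarith [hx.1], by linarith [hx.2]⟩
    · intro x hx
      have := one_le_F (t := x) (by linarith [hx.1]) (by linarith [hx.2])
      linarith
  have hmem : s ∈ Set.Icc (F (1 - (1 - a)) / F (1 - a)) (F (1 - a) / F a) := by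
    have e : 1 - (1 - a) = a := by ring
    rw [e]
    constructor
    · rw [div_le_iff₀ (by linarith)]
      have h3 : 1 / s * F a ≤ F (1 - a) := by nlinarith
      have h4 := mul_le_mul_of_nonneg_left h3 hs.le
      have h5 : s * (1 / s * F a) = F a := by field_simp
      linarith
    · rw [le_div_iff₀ (by linarith)]
      nlinarith
  obtain ⟨x, hx, hxs⟩ := intermediate_value_Icc' (by linarith) hcont hmem
  exact ⟨x, by linarith [hx.1], by linarith [hx.2], hxs⟩

end EllipticAux

open EllipticAux in
/-- For every `r > 0` the equation for the singular modulus has exactly one solution. -/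
theorem existsUnique_isSingularModulus {r : ℝ} (hr : 0 < r) : ∃! k, IsSingularModulus r k := by
  obtain ⟨x, hx0, hx1, hx⟩ := exists_ratio (Real.sqrt_pos.2 hr)
  have hk0 : 0 < Real.sqrt x := Real.sqrt_pos.2 hx0
  have hk1 : Real.sqrt x < 1 := by
    rw [Real.sqrt_lt' one_pos]
    simpa using hx1
  refine ⟨Real.sqrt x, ⟨hk0, hk1, ?_⟩, ?_⟩
  · rw [ratio_eq hk0.le hk1.le, Real.sq_sqrt hx0.le, hx]
  · rintro k ⟨h0, h1, h⟩
    rw [ratio_eq h0.le h1.le, ← hx] at h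
    have hk : k ^ 2 = x := by
      rcases lt_trichotomy (k ^ 2) x with hlt | heq | hgt
      · exact absurd h (ratio_anti (by positivity) hlt hx1).ne'
      · exact heq
      · exact absurd h (ratio_anti hx0 hgt (by nlinarith)).ne
    rw [← hk, Real.sqrt_sq h0.le]

/-- The singular modulus `k_r`: for `r > 0`, the unique solution `k` in `(0, 1)` of
`K(√(1 - k²)) / K(k) = √r`. -/
noncomputable def singularModulus (r : ℝ) : ℝ :=
  Classical.epsilon (IsSingularModulus r)

theorem isSingularModulus_singularModulus {r : ℝ} (hr : 0 < r) :
    IsSingularModulus r (singularModulus r) :=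
  Classical.epsilon_spec (existsUnique_isSingularModulus hr).exists

/-- The nome `q = e^{-π√r}`. -/
noncomputable def nome (r : ℝ) : ℝ := Real.exp (-(Real.pi * Real.sqrt r))

/-- The `n`-th term of the series defining `cd₁(q, u)`, where `q = e^{-π√r}` and `K = K(k_r)`:
`(-1)ⁿ q^{n + 1/2} cos((2n + 3) (π / (2K)) u) / (1 - q^{2n + 1})`. -/
noncomputable def cdOneTerm (r u : ℝ) (n : ℕ) : ℝ :=
  (-1) ^ n * nome r ^ ((n : ℝ) + 1 / 2) *
    Real.cos ((2 * (n : ℝ) + 3) * (Real.pi / (2 * ellipticK (singularModulus r))) * u) /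
      (1 - nome r ^ (2 * n + 1))

/-- The function `cd₁(q, u)` for `q = e^{-π√r}` and real `u`:
`(2π / (K k_r)) ∑_{n ≥ 0} (-1)ⁿ q^{n + 1/2} cos((2n + 3) π u / (2K)) / (1 - q^{2n + 1})`. -/
noncomputable def cdOne (r u : ℝ) : ℝ :=
  2 * Real.pi / (ellipticK (singularModulus r) * singularModulus r) * ∑' n, cdOneTerm r u n

/-- The Jacobi symbol `(a / m)`, extended to even `m ≥ 1` by Kronecker's rule: it is the product
over the prime factors `p` of `m`, with multiplicity, of the Legendre symbols `(a / p)` for odd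
`p` and, for `p = 2`, of `(a / 2)`, which is `0` for even `a`, `1` for `a ≡ ±1 (mod 8)` and `-1`
for `a ≡ ±3 (mod 8)`. Mathlib's `jacobiSym` agrees with it for odd `m` only. -/
def kroneckerSymbol (a : ℤ) (m : ℕ) : ℤ :=
  (m.primeFactorsList.map fun p => if p = 2 then ZMod.χ₈ (a : ZMod 8) else jacobiSym a p).prod

/-- The arithmetical function `χ(n) = ((n + 2) / 8)`. -/
def chi (n : ℕ) : ℤ := kroneckerSymbol ((n : ℤ) + 2) 8

/-! Everything is expressed through the theta constants `thetaThree`, `thetaFour`, `thetaTwoReduced`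
(θ₃, θ₄ and q^(-1/4)θ₂, the last written ϑ₂ here).

Elliptic side. Landen's transformation `F_landen` and the duplication formulas for theta squares
make F(k²)/θ₃² invariant under q ↦ q², where k² = θ₂⁴/θ₃⁴. Since it tends to 1 at q = 0, K =
(π/2)θ₃² (`F_modulusSq`). Poisson summation turns k'(q) into k at the dual nome, so k_r = θ₂²/θ₃² at
q = e^(-π√r) (`singularModulus_eq`).

Lambert side. Let L(z) = ∑ (-1)ⁿ qⁿ zⁿ/(1 - q^(2n+1)) over all integers n. Comparing coefficients of
z^N gives L(z)·∑ q^(m²)z^m = c·∑ q^(m²+m)z^m with c independent of z (`lambertSum_mul_thetaSum`). At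
z = 1, Clausen's transformation and again invariance under q ↦ q² yield c = θ₃ϑ₂/2. At z = i the
identity, squared, evaluates S = ∑ (-1)^⌊n/2⌋ qⁿ/(1 - q^(2n+1)) over n ≥ 0 as θ₃(q)ϑ₂(q²)/2
(`tsum_neg_one_pow_half_mul_lambertCoeff`).

The character series is -√q·S. In cd₁(q, K/2) the cosines are ±√2/2, and the signs produce S - 2A,
where A collects the even n: S gives 1/√(1 + k') and A gives the series over n ≡ 1 (mod 4). -/

/-! ### Wallis ratios and the expansion of (1 - z)^(-1/2) -/

open Finset in
/-- The Wallis ratio `(1/2)ₙ / n!`, the coefficient of `zⁿ` in `(1 - z)^(-1/2)`. -/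
noncomputable def wallisRatio (n : ℕ) : ℝ := ∏ i ∈ range n, (2 * (i : ℝ) + 1) / (2 * i + 2)

theorem wallisRatio_zero : wallisRatio 0 = 1 := by simp [wallisRatio]

theorem wallisRatio_succ (n : ℕ) :
    wallisRatio (n + 1) = wallisRatio n * ((2 * (n : ℝ) + 1) / (2 * n + 2)) := by
  rw [wallisRatio, wallisRatio, Finset.prod_range_succ]

theorem wallisRatio_pos (n : ℕ) : 0 < wallisRatio n :=
  Finset.prod_pos fun i _ => by positivity

theorem wallisRatio_le_one (n : ℕ) : wallisRatio n ≤ 1 :=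
  Finset.prod_le_one (fun i _ => by positivity) fun i _ => by
    rw [div_le_one (by positivity)]; linarith

theorem coeff_eq_wallisRatio_sq (n : ℕ) : EllipticAux.coeff n = wallisRatio n ^ 2 := by
  induction n with
  | zero => simp [wallisRatio_zero, EllipticAux.coeff, ordinaryHypergeometricCoefficient]
  | succ n ih =>
    rw [EllipticAux.coeff_succ, ih, wallisRatio_succ, mul_pow]
    congr 2
    field_simp

-- Weight the convolution C_m by the first index. Symmetry gives 2∑ i·wᵢwⱼ = m·C_m, while the
-- recurrence (i + 1)wᵢ₊₁ = (i + 1/2)wᵢ turns the weighted sum at n + 1 into (n + 1)·C_n. Hence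
-- C_(n+1) = C_n.
open Finset in
theorem sum_antidiagonal_wallisRatio (n : ℕ) :
    ∑ p ∈ antidiagonal n, wallisRatio p.1 * wallisRatio p.2 = 1 := by
  induction n with
  | zero => simp [wallisRatio_zero]
  | succ n ih =>
    have hswap : ∀ m : ℕ, ∑ p ∈ antidiagonal m, (p.2 : ℝ) * (wallisRatio p.1 * wallisRatio p.2) =
        ∑ p ∈ antidiagonal m, (p.1 : ℝ) * (wallisRatio p.1 * wallisRatio p.2) := by
      intro m
      rw [← Nat.sum_antidiagonal_swap]
      exact sum_congr rfl fun p _ => by simp [mul_comm]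
    have htot : ∀ m : ℕ, 2 * ∑ p ∈ antidiagonal m, (p.1 : ℝ) * (wallisRatio p.1 * wallisRatio p.2) =
        m * ∑ p ∈ antidiagonal m, wallisRatio p.1 * wallisRatio p.2 := by
      intro m
      rw [two_mul]
      nth_rewrite 1 [← hswap]
      rw [← sum_add_distrib, mul_sum]
      refine sum_congr rfl fun p hp => ?_
      have : (p.1 : ℝ) + p.2 = m := by exact_mod_cast mem_antidiagonal.1 hp
      rw [← this]; ring
    have h1 := htot (n + 1)
    have h2 := htot n
    rw [Nat.sum_antidiagonal_succ] at h1
    have h3 : 2 * ∑ p ∈ antidiagonal n, ((p.1 + 1 : ℕ) : ℝ) *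
        (wallisRatio (p.1 + 1) * wallisRatio p.2) =
        2 * ∑ p ∈ antidiagonal n, (p.1 : ℝ) * (wallisRatio p.1 * wallisRatio p.2) +
          ∑ p ∈ antidiagonal n, wallisRatio p.1 * wallisRatio p.2 := by
      rw [mul_sum, mul_sum, ← sum_add_distrib]
      refine sum_congr rfl fun p _ => ?_
      rw [wallisRatio_succ]
      push_cast
      field_simp
    simp only [Nat.cast_zero, zero_mul, zero_add] at h1
    rw [h3, h2, ih] at h1
    push_cast at h1
    have : ((n : ℝ) + 1) ≠ 0 := by positivity
    apply mul_left_cancel₀ this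
    linarith

section
variable {𝕜 : Type*} [RCLike 𝕜]

theorem norm_wallisRatio_mul_pow_le (z : 𝕜) (n : ℕ) :
    ‖(wallisRatio n : 𝕜) * z ^ n‖ ≤ ‖z‖ ^ n := by
  rw [norm_mul, norm_pow, RCLike.norm_ofReal, abs_of_pos (wallisRatio_pos n)]
  exact mul_le_of_le_one_left (by positivity) (wallisRatio_le_one n)

theorem summable_norm_wallisRatio_mul_pow {z : 𝕜} (hz : ‖z‖ < 1) :
    Summable fun n => ‖(wallisRatio n : 𝕜) * z ^ n‖ :=
  Summable.of_nonneg_of_le (fun _ => norm_nonneg _) (norm_wallisRatio_mul_pow_le z)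
    (summable_geometric_of_lt_one (norm_nonneg z) hz)

open Finset in
theorem tsum_wallisRatio_mul_pow_sq {z : 𝕜} (hz : ‖z‖ < 1) :
    (∑' n, (wallisRatio n : 𝕜) * z ^ n) ^ 2 = (1 - z)⁻¹ := by
  have hs := summable_norm_wallisRatio_mul_pow hz
  rw [sq, tsum_mul_tsum_eq_tsum_sum_antidiagonal_of_summable_norm hs hs,
    ← tsum_geometric_of_norm_lt_one hz]
  refine tsum_congr fun n => ?_
  have h : ((∑ p ∈ antidiagonal n, wallisRatio p.1 * wallisRatio p.2 : ℝ) : 𝕜) = 1 := by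
    rw [sum_antidiagonal_wallisRatio, RCLike.ofReal_one]
  rw [← one_mul (z ^ n), ← h, RCLike.ofReal_sum, Finset.sum_mul]
  refine Finset.sum_congr rfl fun p hp => ?_
  rw [← mem_antidiagonal.1 hp, RCLike.ofReal_mul, pow_add]
  ring

end

theorem hasSum_wallisRatio_mul_pow {t : ℝ} (h0 : 0 ≤ t) (h1 : t < 1) :
    HasSum (fun n => wallisRatio n * t ^ n) (Real.sqrt (1 - t))⁻¹ := by
  have ht : ‖t‖ < 1 := by rwa [Real.norm_of_nonneg h0]
  have hs := (summable_norm_wallisRatio_mul_pow ht).of_norm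
  have h := tsum_wallisRatio_mul_pow_sq ht
  simp only [RCLike.ofReal_real_eq_id, id] at h hs
  have hpos : 0 ≤ ∑' n, wallisRatio n * t ^ n :=
    tsum_nonneg fun n => mul_nonneg (wallisRatio_pos n).le (pow_nonneg h0 n)
  rw [← Real.sqrt_inv, ← h, Real.sqrt_sq hpos]
  exact hs.hasSum

/-! ### Two integral representations of F and Landen's transformation -/

/-- Expand binomially and integrate termwise: Wallis' integral of sin^(2n) supplies the second
factor `wallisRatio n` of the hypergeometric coefficient. -/
theorem integral_inv_sqrt_one_sub_mul_sin_sq {t : ℝ} (h0 : 0 ≤ t) (h1 : t < 1) :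
    ∫ φ in (0 : ℝ)..Real.pi, (Real.sqrt (1 - t * Real.sin φ ^ 2))⁻¹ =
      Real.pi * EllipticAux.F t := by
  have hle : ∀ φ, t * Real.sin φ ^ 2 ≤ t := fun φ =>
    mul_le_of_le_one_right h0 (Real.sin_sq_le_one φ)
  have h := intervalIntegral.hasSum_integral_of_dominated_convergence
    (μ := MeasureTheory.volume) (a := 0) (b := Real.pi)
    (F := fun (n : ℕ) φ => wallisRatio n * (t * Real.sin φ ^ 2) ^ n)
    (f := fun φ => (Real.sqrt (1 - t * Real.sin φ ^ 2))⁻¹)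
    (fun n _ => t ^ n)
    (fun n => (by fun_prop : Continuous fun φ : ℝ =>
      wallisRatio n * (t * Real.sin φ ^ 2) ^ n).aestronglyMeasurable)
    (fun n => .of_forall fun φ _ => ?_)
    (.of_forall fun φ _ => summable_geometric_of_lt_one h0 h1)
    (by simp)
    (.of_forall fun φ _ => hasSum_wallisRatio_mul_pow (by positivity) ((hle φ).trans_lt h1))
  · refine h.unique ?_
    refine ((EllipticAux.hasSum_F h0 h1).mul_left Real.pi).congr_fun fun n => ?_
    rw [coeff_eq_wallisRatio_sq, intervalIntegral.integral_const_mul]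
    simp_rw [mul_pow, ← pow_mul]
    rw [intervalIntegral.integral_const_mul, integral_sin_pow_even, wallisRatio]
    ring
  · have h2 : 0 ≤ t * Real.sin φ ^ 2 := by positivity
    rw [norm_mul, Real.norm_of_nonneg (wallisRatio_pos n).le, norm_pow, Real.norm_of_nonneg h2]
    exact (mul_le_of_le_one_left (by positivity) (wallisRatio_le_one n)).trans
      (pow_le_pow_left₀ h2 (hle φ) n)

open Complex in
theorem norm_one_add_mul_exp (x φ : ℝ) :
    ‖1 - -(x : ℂ) * exp (2 * φ * I)‖ = Real.sqrt ((1 + x) ^ 2 - 4 * x * Real.sin φ ^ 2) := by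
  have h : (1 : ℂ) - -(x : ℂ) * exp (2 * φ * I) =
      ((1 + x * Real.cos (2 * φ) : ℝ) : ℂ) + ((x * Real.sin (2 * φ) : ℝ) : ℂ) * I := by
    rw [exp_mul_I]
    push_cast
    ring
  rw [h, norm_add_mul_I]
  congr 1
  rw [Real.cos_two_mul, Real.sin_two_mul]
  have := Real.sin_sq_add_cos_sq φ
  have hc : Real.cos φ ^ 2 = 1 - Real.sin φ ^ 2 := by linarith
  simp only [mul_pow, hc]
  ring

open Complex in
theorem integral_exp_two_mul_int_mul_I (k : ℤ) :
    ∫ φ in (0 : ℝ)..Real.pi, exp (2 * k * I * φ) = if k = 0 then (Real.pi : ℂ) else 0 := by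
  split_ifs with h
  · simp [h]
  · have hc : (2 * k * I : ℂ) ≠ 0 := by simp [h]
    rw [integral_exp_mul_complex hc]
    have : exp (2 * k * I * Real.pi) = 1 := by
      rw [← exp_int_mul_two_pi_mul_I k]
      congr 1
      ring
    simp [this]

-- A Parseval argument. The integrand is 1/|1 + x e^(2iφ)| = |f|², where f = ∑ wₙ(-x e^(2iφ))ⁿ
-- satisfies f² = 1/(1 + x e^(2iφ)). By orthogonality only the diagonal terms wₙ²x^(2n) survive.
open Complex ComplexConjugate in
theorem integral_inv_sqrt_sub_mul_sin_sq {x : ℝ} (h0 : 0 ≤ x) (h1 : x < 1) :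
    ∫ φ in (0 : ℝ)..Real.pi, (Real.sqrt ((1 + x) ^ 2 - 4 * x * Real.sin φ ^ 2))⁻¹ =
      Real.pi * EllipticAux.F (x ^ 2) := by
  have hz : ∀ φ : ℝ, ‖-(x : ℂ) * exp (2 * φ * I)‖ = x := by
    intro φ
    have : ‖exp (2 * φ * I)‖ = 1 := by
      simpa using norm_exp_ofReal_mul_I (2 * φ)
    rw [norm_mul, this, norm_neg, norm_real, Real.norm_of_nonneg h0, mul_one]
  have hgeo := summable_geometric_of_lt_one h0 h1
  have hint : ∀ p : ℕ × ℕ, ∫ φ in (0 : ℝ)..Real.pi,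
      ((wallisRatio p.1 : ℂ) * (-(x : ℂ) * exp (2 * φ * I)) ^ p.1) *
        conj ((wallisRatio p.2 : ℂ) * (-(x : ℂ) * exp (2 * φ * I)) ^ p.2) =
      wallisRatio p.1 * wallisRatio p.2 * (-(x : ℂ)) ^ (p.1 + p.2) *
        if (p.1 : ℤ) - p.2 = 0 then (Real.pi : ℂ) else 0 := by
    intro p
    rw [← integral_exp_two_mul_int_mul_I, ← intervalIntegral.integral_const_mul]
    refine intervalIntegral.integral_congr fun φ _ => ?_
    have h2 : conj (exp (2 * φ * I)) = exp (-(2 * φ * I)) := by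
      rw [← exp_conj, map_mul, map_mul, conj_I, conj_ofReal, map_ofNat, mul_neg]
    have h3 : exp (2 * ((p.1 : ℤ) - p.2 : ℤ) * I * φ) =
        exp (2 * φ * I) ^ p.1 * exp (-(2 * φ * I)) ^ p.2 := by
      rw [← exp_nat_mul, ← exp_nat_mul, ← exp_add]
      congr 1
      push_cast
      ring
    simp only [map_mul, map_pow, map_neg, conj_ofReal, h2, h3, mul_pow, pow_add]
    ring
  have h := intervalIntegral.hasSum_integral_of_dominated_convergence
    (μ := MeasureTheory.volume) (a := 0) (b := Real.pi)
    (F := fun (p : ℕ × ℕ) (φ : ℝ) => ((wallisRatio p.1 : ℂ) * (-(x : ℂ) * exp (2 * φ * I)) ^ p.1) *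
      conj ((wallisRatio p.2 : ℂ) * (-(x : ℂ) * exp (2 * φ * I)) ^ p.2))
    (f := fun φ => (((Real.sqrt ((1 + x) ^ 2 - 4 * x * Real.sin φ ^ 2))⁻¹ : ℝ) : ℂ))
    (fun p _ => x ^ p.1 * x ^ p.2)
    (fun p => Continuous.aestronglyMeasurable (by fun_prop))
    (fun p => .of_forall fun φ _ => ?_)
    (.of_forall fun φ _ => hgeo.mul_of_nonneg hgeo (fun _ => by positivity) fun _ => by positivity)
    (by simp)
    (.of_forall fun φ _ => ?_)
  · rw [← ofReal_inj, ← intervalIntegral.integral_ofReal]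
    refine h.unique ?_
    have hF := (EllipticAux.hasSum_F (sq_nonneg x) (by nlinarith)).mul_left Real.pi
    have hF' : HasSum (fun n => ((Real.pi * (EllipticAux.coeff n * (x ^ 2) ^ n) : ℝ) : ℂ))
      ((Real.pi * EllipticAux.F (x ^ 2) : ℝ) : ℂ) := hasSum_ofReal.2 hF
    have hinj : Function.Injective fun n : ℕ => (n, n) := fun a b h => (Prod.ext_iff.1 h).1
    refine (hinj.hasSum_iff ?_).1 ?_
    · rintro ⟨m, n⟩ hmn
      rw [hint, if_neg, mul_zero]
      intro h
      exact hmn ⟨m, Prod.ext rfl (by dsimp only; omega)⟩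
    · refine hF'.congr_fun fun n => ?_
      refine (hint (n, n)).trans ?_
      simp only [sub_self, if_true]
      rw [coeff_eq_wallisRatio_sq]
      push_cast
      rw [← two_mul, pow_mul, neg_sq]
      ring
  · rw [norm_mul, RCLike.norm_conj]
    have := norm_wallisRatio_mul_pow_le (-(x : ℂ) * exp (2 * φ * I))
    rw [hz] at this
    exact mul_le_mul (this _) (this _) (norm_nonneg _) (by positivity)
  · have hs : Summable fun n => ‖(wallisRatio n : ℂ) * (-(x : ℂ) * exp (2 * φ * I)) ^ n‖ :=
      summable_norm_wallisRatio_mul_pow ((hz φ).trans_lt h1)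
    have h2 : (∑' n, (wallisRatio n : ℂ) * (-(x : ℂ) * exp (2 * φ * I)) ^ n) ^ 2 =
        (1 - -(x : ℂ) * exp (2 * φ * I))⁻¹ := tsum_wallisRatio_mul_pow_sq ((hz φ).trans_lt h1)
    have hs' : Summable fun n =>
        ‖conj ((wallisRatio n : ℂ) * (-(x : ℂ) * exp (2 * φ * I)) ^ n)‖ := by
      simpa only [RCLike.norm_conj] using hs
    have h3 := (summable_mul_of_summable_norm hs hs').hasSum
    rw [← tsum_mul_tsum_of_summable_norm hs hs', ← conj_tsum, mul_conj, normSq_eq_norm_sq,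
      ← norm_pow, h2, norm_inv, norm_one_add_mul_exp] at h3
    exact h3

/-- Landen's transformation. -/
theorem F_landen {x : ℝ} (h0 : 0 ≤ x) (h1 : x < 1) :
    EllipticAux.F (4 * x / (1 + x) ^ 2) = (1 + x) * EllipticAux.F (x ^ 2) := by
  have hx : 0 < 1 + x := by linarith
  have ht1 : 4 * x / (1 + x) ^ 2 < 1 := by
    rw [div_lt_one (by positivity)]
    nlinarith [mul_pos (sub_pos.2 h1) (sub_pos.2 h1)]
  have h := integral_inv_sqrt_one_sub_mul_sin_sq (t := 4 * x / (1 + x) ^ 2) (by positivity) ht1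
  have h' := integral_inv_sqrt_sub_mul_sin_sq h0 h1
  -- At t = 4x/(1 + x)² the two integrands differ only by the constant factor 1 + x.
  have hfun : ∀ φ : ℝ, (Real.sqrt (1 - 4 * x / (1 + x) ^ 2 * Real.sin φ ^ 2))⁻¹ =
      (1 + x) * (Real.sqrt ((1 + x) ^ 2 - 4 * x * Real.sin φ ^ 2))⁻¹ := by
    intro φ
    have : (1 + x) ^ 2 - 4 * x * Real.sin φ ^ 2 =
        (1 + x) ^ 2 * (1 - 4 * x / (1 + x) ^ 2 * Real.sin φ ^ 2) := by field_simp
    rw [this, Real.sqrt_mul (by positivity), Real.sqrt_sq hx.le, mul_inv]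
    field_simp
  simp_rw [hfun] at h
  rw [intervalIntegral.integral_const_mul, h'] at h
  have := Real.pi_pos.ne'
  apply mul_left_cancel₀ this
  linarith

/-! ### Theta series and duplication formulas for their squares -/

section
variable {q : ℝ} {z : ℂ}

theorem summable_zpow_of_abs_sub_le (h0 : 0 < q) (h1 : q < 1) {f : ℤ → ℤ} (c : ℤ)
    (hf : ∀ m, |m| - c ≤ f m) : Summable fun m => q ^ f m := by
  have h : Summable fun m : ℤ => q ^ |m| := by
    have hg := summable_geometric_of_lt_one h0.le h1
    refine Summable.of_nat_of_neg ?_ ?_ <;> simpa using hg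
  refine Summable.of_nonneg_of_le (fun m => (zpow_pos h0 _).le) (fun m => ?_) (h.mul_left (q ^ (-c)))
  rw [← zpow_add₀ h0.ne']
  exact zpow_le_zpow_right_of_le_one₀ h0 h1.le (by linarith [hf m])

theorem abs_le_sq (m : ℤ) : |m| ≤ m ^ 2 := by
  rw [← sq_abs]
  exact Int.le_self_sq _

theorem abs_sub_one_le_sq_add (m : ℤ) : |m| - 1 ≤ m ^ 2 + m := by
  rcases abs_cases m with ⟨h, h'⟩ | ⟨h, h'⟩ <;> rw [h] <;> nlinarith [sq_nonneg (m + 1)]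

theorem summable_zpow_sq (h0 : 0 < q) (h1 : q < 1) : Summable fun m : ℤ => q ^ m ^ 2 :=
  summable_zpow_of_abs_sub_le h0 h1 0 fun m => by simpa using abs_le_sq m

theorem summable_zpow_sq_add (h0 : 0 < q) (h1 : q < 1) : Summable fun m : ℤ => q ^ (m ^ 2 + m) :=
  summable_zpow_of_abs_sub_le h0 h1 1 abs_sub_one_le_sq_add

theorem norm_zpow_mul_zpow (h0 : 0 < q) (hz : ‖z‖ = 1) (k m : ℤ) :
    ‖(q : ℂ) ^ k * z ^ m‖ = q ^ k := by
  rw [norm_mul, norm_zpow, norm_zpow, hz, one_zpow, mul_one, Complex.norm_real,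
    Real.norm_of_nonneg h0.le]

/-- The theta function `∑ q^(m²) z^m`. -/
noncomputable def thetaSum (q : ℝ) (z : ℂ) : ℂ := ∑' m : ℤ, (q : ℂ) ^ m ^ 2 * z ^ m

/-- The theta function `∑ q^(m² + m) z^m`. -/
noncomputable def thetaHalfSum (q : ℝ) (z : ℂ) : ℂ := ∑' m : ℤ, (q : ℂ) ^ (m ^ 2 + m) * z ^ m

theorem summable_norm_thetaSum (h0 : 0 < q) (h1 : q < 1) (hz : ‖z‖ = 1) :
    Summable fun m : ℤ => ‖(q : ℂ) ^ m ^ 2 * z ^ m‖ := by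
  simpa only [norm_zpow_mul_zpow h0 hz] using summable_zpow_sq h0 h1

theorem summable_norm_thetaHalfSum (h0 : 0 < q) (h1 : q < 1) (hz : ‖z‖ = 1) :
    Summable fun m : ℤ => ‖(q : ℂ) ^ (m ^ 2 + m) * z ^ m‖ := by
  simpa only [norm_zpow_mul_zpow h0 hz] using summable_zpow_sq_add h0 h1

/-- Pairs of integers, split according to the parity of their sum. -/
noncomputable def paritySplit : (ℤ × ℤ) ⊕ (ℤ × ℤ) ≃ ℤ × ℤ :=
  Equiv.ofBijective
    (Sum.elim (fun p => (p.1 + p.2, p.1 - p.2)) fun p => (p.1 + p.2 + 1, p.1 - p.2)) (by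
    constructor
    · rintro (⟨a, b⟩ | ⟨a, b⟩) (⟨c, d⟩ | ⟨c, d⟩) h <;>
        simp only [Sum.elim_inl, Sum.elim_inr, Prod.mk.injEq, Sum.inl.injEq, Sum.inr.injEq,
          reduceCtorEq] at h ⊢ <;> omega
    · rintro ⟨m, n⟩
      rcases Int.even_or_odd' (m + n) with ⟨c, h | h⟩
      · exact ⟨Sum.inl (c, m - c), by simp only [Sum.elim_inl, Prod.mk.injEq]; omega⟩
      · exact ⟨Sum.inr (c, m - c - 1), by simp only [Sum.elim_inr, Prod.mk.injEq]; omega⟩)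

theorem paritySplit_inl (p : ℤ × ℤ) : paritySplit (Sum.inl p) = (p.1 + p.2, p.1 - p.2) := rfl

theorem paritySplit_inr (p : ℤ × ℤ) : paritySplit (Sum.inr p) = (p.1 + p.2 + 1, p.1 - p.2) := rfl

theorem tsum_equiv_sum {α β γ E : Type*} [NormedAddCommGroup E] [CompleteSpace E]
    (e : α ⊕ β ≃ γ) {f : γ → E} (hf : Summable f) :
    ∑' c, f c = ∑' a, f (e (Sum.inl a)) + ∑' b, f (e (Sum.inr b)) := by
  have h1 : HasSum ((f ∘ e) ∘ Sum.inl) (∑' a, f (e (Sum.inl a))) :=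
    (hf.comp_injective (e.injective.comp Sum.inl_injective)).hasSum
  have h2 : HasSum ((f ∘ e) ∘ Sum.inr) (∑' a, f (e (Sum.inr a))) :=
    (hf.comp_injective (e.injective.comp Sum.inr_injective)).hasSum
  exact ((e.hasSum_iff).1 (h1.sum h2)).tsum_eq

theorem tsum_mul_tsum_parity {f g : ℤ → ℂ} (hf : Summable fun m => ‖f m‖)
    (hg : Summable fun m => ‖g m‖) :
    (∑' m, f m) * ∑' m, g m = ∑' p : ℤ × ℤ, f (p.1 + p.2) * g (p.1 - p.2) +
      ∑' p : ℤ × ℤ, f (p.1 + p.2 + 1) * g (p.1 - p.2) := by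
  have hs : Summable fun p : ℤ × ℤ => f p.1 * g p.2 := summable_mul_of_summable_norm hf hg
  rw [tsum_mul_tsum_of_summable_norm hf hg, tsum_equiv_sum paritySplit hs]
  simp only [paritySplit_inl, paritySplit_inr]

theorem ofReal_sq_zpow (q : ℝ) (k : ℤ) : ((q ^ 2 : ℝ) : ℂ) ^ k = (q : ℂ) ^ (2 * k) := by
  rw [zpow_mul]
  norm_cast

theorem tsum_prod_eq_mul {f g : ℤ → ℂ} (hf : Summable fun m => ‖f m‖)
    (hg : Summable fun m => ‖g m‖) {h : ℤ × ℤ → ℂ} (c : ℂ) (hh : ∀ p, h p = c * (f p.1 * g p.2)) :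
    ∑' p, h p = c * ((∑' m, f m) * ∑' m, g m) := by
  rw [tsum_mul_tsum_of_summable_norm hf hg, ← tsum_mul_left]
  exact tsum_congr hh

theorem zpow_mul_zpow_mul {a b : ℂ} (ha : a ≠ 0) (hb : b ≠ 0) (i j k l : ℤ) :
    a ^ i * b ^ j * (a ^ k * b ^ l) = a ^ (i + k) * b ^ (j + l) := by
  rw [zpow_add₀ ha, zpow_add₀ hb]
  ring

theorem sq_zpow_mul_zpow_mul (q : ℝ) (hq : (q : ℂ) ≠ 0) (z : ℂ) (i j k l : ℤ) :
    ((q ^ 2 : ℝ) : ℂ) ^ i * (z ^ 2) ^ j * (((q ^ 2 : ℝ) : ℂ) ^ k * 1 ^ l) =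
      (q : ℂ) ^ (2 * i + 2 * k) * z ^ (2 * j) := by
  rw [ofReal_sq_zpow, ofReal_sq_zpow, one_zpow, mul_one, zpow_add₀ hq, zpow_mul z, zpow_ofNat]
  ring

/-- Split pairs (m, n) by the parity of m + n. For (a + b, a - b) the exponent is 2a² + 2b²; for (a
+ b + 1, a - b) it is 2(a² + a) + 2(b² + b) + 1. Both double sums therefore factor. -/
theorem thetaSum_sq (h0 : 0 < q) (h1 : q < 1) (hz : ‖z‖ = 1) :
    thetaSum q z ^ 2 = thetaSum (q ^ 2) (z ^ 2) * thetaSum (q ^ 2) 1 +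
      q * z * (thetaHalfSum (q ^ 2) (z ^ 2) * thetaHalfSum (q ^ 2) 1) := by
  have hs := summable_norm_thetaSum h0 h1 hz
  have hq0 : (q : ℂ) ≠ 0 := by exact_mod_cast h0.ne'
  have hz0 : z ≠ 0 := by rintro rfl; simp at hz
  have h0' : 0 < q ^ 2 := by positivity
  have h1' : q ^ 2 < 1 := by nlinarith
  have hz' : ‖z ^ 2‖ = 1 := by simp [hz]
  have h11 : ‖(1 : ℂ)‖ = 1 := norm_one
  rw [sq, thetaSum, tsum_mul_tsum_parity hs hs,
    ← one_mul (thetaSum (q ^ 2) (z ^ 2) * thetaSum (q ^ 2) 1)]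
  congr 1
  · refine tsum_prod_eq_mul (summable_norm_thetaSum h0' h1' hz')
      (summable_norm_thetaSum h0' h1' h11) _ fun p => ?_
    rw [sq_zpow_mul_zpow_mul q hq0, zpow_mul_zpow_mul hq0 hz0, one_mul]
    congr 2 <;> ring
  · refine tsum_prod_eq_mul (summable_norm_thetaHalfSum h0' h1' hz')
      (summable_norm_thetaHalfSum h0' h1' h11) _ fun p => ?_
    rw [sq_zpow_mul_zpow_mul q hq0, zpow_mul_zpow_mul hq0 hz0, mul_mul_mul_comm,
      ← zpow_one_add₀ hq0, ← zpow_one_add₀ hz0]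
    congr 2 <;> ring

theorem thetaHalfSum_sq (h0 : 0 < q) (h1 : q < 1) (hz : ‖z‖ = 1) :
    thetaHalfSum q z ^ 2 = thetaHalfSum (q ^ 2) (z ^ 2) * thetaSum (q ^ 2) 1 +
      z⁻¹ * (thetaSum (q ^ 2) (z ^ 2) * thetaHalfSum (q ^ 2) 1) := by
  have hs := summable_norm_thetaHalfSum h0 h1 hz
  have hq0 : (q : ℂ) ≠ 0 := by exact_mod_cast h0.ne'
  have hz0 : z ≠ 0 := by rintro rfl; simp at hz
  have h0' : 0 < q ^ 2 := by positivity
  have h1' : q ^ 2 < 1 := by nlinarith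
  have hz' : ‖z ^ 2‖ = 1 := by simp [hz]
  have h11 : ‖(1 : ℂ)‖ = 1 := norm_one
  rw [sq, thetaHalfSum, tsum_mul_tsum_parity hs hs,
    ← one_mul (thetaHalfSum (q ^ 2) (z ^ 2) * thetaSum (q ^ 2) 1)]
  congr 1
  · refine tsum_prod_eq_mul (summable_norm_thetaHalfSum h0' h1' hz')
      (summable_norm_thetaSum h0' h1' h11) _ fun p => ?_
    rw [sq_zpow_mul_zpow_mul q hq0, zpow_mul_zpow_mul hq0 hz0, one_mul]
    congr 2 <;> ring
  · have ht : Summable fun m : ℤ => ‖((q ^ 2 : ℝ) : ℂ) ^ (m + 1) ^ 2 * (z ^ 2) ^ (m + 1)‖ :=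
      (summable_norm_thetaSum h0' h1' hz').comp_injective (add_left_injective (1 : ℤ))
    -- For odd m + n the exponent is 2(a + 1)² + 2(b² + b) and the power of z is 2(a + 1) - 1; hence
    -- the shift by 1 and the factor z⁻¹.
    rw [thetaSum, ← (Equiv.addRight (1 : ℤ)).tsum_eq]
    refine tsum_prod_eq_mul ht (summable_norm_thetaHalfSum h0' h1' h11) _ fun p => ?_
    rw [sq_zpow_mul_zpow_mul q hq0, zpow_mul_zpow_mul hq0 hz0, ← zpow_neg_one, mul_left_comm,
      ← zpow_add₀ hz0]
    congr 2 <;> ring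

/-- The reflection m ↦ -1 - m preserves m² + m and reverses the sign (-1)^m. -/
theorem thetaHalfSum_neg_one (q : ℝ) : thetaHalfSum q (-1) = 0 := by
  have h : thetaHalfSum q (-1) = -thetaHalfSum q (-1) := by
    conv_lhs => rw [thetaHalfSum, ← (Equiv.subLeft (-1 : ℤ)).tsum_eq]
    rw [thetaHalfSum, ← tsum_neg]
    refine tsum_congr fun m => ?_
    have hm : (-1 : ℂ) ^ (-1 - m) = -(-1) ^ m := by
      rw [zpow_sub₀ (by norm_num), zpow_neg_one, div_eq_mul_inv, ← inv_zpow]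
      norm_num
    rw [Equiv.subLeft_apply, hm, mul_neg]
    congr 3
    ring
  exact self_eq_neg.1 h

end

/-! ### The bilateral Lambert series times a theta series -/

section
variable {q : ℝ} {z : ℂ}

/-- The coefficient `qⁿ / (1 - q^(2n+1))`. -/
noncomputable def lambertCoeff (q : ℝ) (n : ℤ) : ℝ := q ^ n / (1 - q ^ (2 * n + 1))

theorem one_sub_zpow_ne_zero (h0 : 0 < q) (h1 : q < 1) (n : ℤ) : 1 - q ^ (2 * n + 1) ≠ 0 := by
  rw [sub_ne_zero]
  intro h
  have := (zpow_eq_one_iff_right₀ h0.le h1.ne).1 h.symm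
  omega

theorem lambertCoeff_neg (h0 : 0 < q) (h1 : q < 1) (n : ℤ) :
    lambertCoeff q (-1 - n) = -lambertCoeff q n := by
  have e1 : q ^ (-1 - n) = q ^ n * (q ^ (2 * n + 1))⁻¹ := by
    rw [← zpow_neg, ← zpow_add₀ h0.ne']
    congr 1
    ring
  have e2 : q ^ (2 * (-1 - n) + 1) = (q ^ (2 * n + 1))⁻¹ := by
    rw [← zpow_neg]
    congr 1
    ring
  have h := one_sub_zpow_ne_zero h0 h1 n
  have h3 : q ^ (2 * n + 1) ≠ 0 := (zpow_pos h0 _).ne'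
  have h4 : q ^ (2 * n + 1) - 1 ≠ 0 := by
    rw [← neg_sub]
    exact neg_ne_zero.2 h
  rw [lambertCoeff, lambertCoeff, e1, e2]
  have : 1 - (q ^ (2 * n + 1))⁻¹ = (q ^ (2 * n + 1) - 1) * (q ^ (2 * n + 1))⁻¹ := by field_simp
  rw [this, mul_div_mul_right _ _ (inv_ne_zero h3), ← div_neg, neg_sub]

theorem lambertCoeff_natCast (q : ℝ) (n : ℕ) :
    lambertCoeff q n = q ^ n / (1 - q ^ (2 * n + 1)) := by
  rw [lambertCoeff]
  norm_cast

theorem lambertCoeff_natCast_pos (h0 : 0 < q) (h1 : q < 1) (n : ℕ) : 0 < lambertCoeff q n := by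
  rw [lambertCoeff_natCast]
  have : q ^ (2 * n + 1) < 1 := pow_lt_one₀ h0.le h1 (by omega)
  exact div_pos (by positivity) (by linarith)

theorem lambertCoeff_natCast_le (h0 : 0 < q) (h1 : q < 1) (n : ℕ) :
    lambertCoeff q n ≤ q ^ n / (1 - q) := by
  rw [lambertCoeff_natCast]
  have : q ^ (2 * n + 1) ≤ q := pow_le_of_le_one h0.le h1.le (by omega)
  gcongr

theorem summable_lambertCoeff_natCast (h0 : 0 < q) (h1 : q < 1) :
    Summable fun n : ℕ => lambertCoeff q n :=
  Summable.of_nonneg_of_le (fun n => (lambertCoeff_natCast_pos h0 h1 n).le)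
    (lambertCoeff_natCast_le h0 h1) ((summable_geometric_of_lt_one h0.le h1).div_const _)

theorem summable_abs_lambertCoeff (h0 : 0 < q) (h1 : q < 1) :
    Summable fun n : ℤ => |lambertCoeff q n| := by
  have h := (summable_lambertCoeff_natCast h0 h1).abs
  refine Summable.of_nat_of_neg_add_one h ?_
  refine h.congr fun n => ?_
  rw [← abs_neg, ← lambertCoeff_neg h0 h1]
  congr 2
  ring

/-- The coefficient of `z^N` in the product of `∑ (-1)ⁿ qⁿ zⁿ / (1 - q^(2n+1))` with
`∑ q^(m²) z^m`. -/
noncomputable def lambertThetaCoeff (q : ℝ) (N : ℤ) : ℝ :=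
  ∑' n : ℤ, (-1) ^ n * lambertCoeff q n * q ^ (N - n) ^ 2

theorem summable_lambertThetaCoeff (h0 : 0 < q) (h1 : q < 1) (N : ℤ) :
    Summable fun n : ℤ => (-1) ^ n * lambertCoeff q n * q ^ (N - n) ^ 2 := by
  refine Summable.of_norm_bounded (summable_abs_lambertCoeff h0 h1) fun n => ?_
  rw [norm_mul, norm_mul, Real.norm_eq_abs, Real.norm_eq_abs, abs_neg_one_zpow, one_mul,
    Real.norm_of_nonneg (zpow_pos h0 _).le]
  exact mul_le_of_le_one_right (abs_nonneg _) (zpow_le_one₀ h0 h1.le (sq_nonneg _))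

theorem neg_one_zpow_sub_odd (k m : ℤ) : (-1 : ℝ) ^ (2 * k + 1 - m) = -(-1) ^ m := by
  have h : ((-1 : ℝ)) ≠ 0 := by norm_num
  rw [zpow_sub₀ h, zpow_add₀ h, zpow_mul, div_eq_mul_inv, ← inv_zpow]
  norm_num

/-- The reflection n ↦ 2M + 1 - n preserves the exponent and reverses the sign. -/
theorem tsum_neg_one_zpow_mul_zpow (q : ℝ) (M : ℤ) :
    ∑' n : ℤ, (-1 : ℝ) ^ n * q ^ ((M - n) ^ 2 - n) = 0 := by
  refine self_eq_neg.1 ?_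
  conv_lhs => rw [← (Equiv.subLeft (2 * M + 1)).tsum_eq]
  rw [← tsum_neg]
  refine tsum_congr fun n => ?_
  rw [Equiv.subLeft_apply, neg_one_zpow_sub_odd, neg_mul]
  congr 3
  ring

theorem summable_neg_one_zpow_mul_zpow (h0 : 0 < q) (h1 : q < 1) (M : ℤ) :
    Summable fun n : ℤ => (-1 : ℝ) ^ n * q ^ ((M - n) ^ 2 - n) := by
  refine Summable.of_norm_bounded
    (summable_zpow_of_abs_sub_le h0 h1 (f := fun n => (M - n) ^ 2 - n) (2 * |M| + 1) fun n => ?_)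
    fun n => ?_
  -- With d = |n| - |M|, the bound d² ≥ 2d - 1 yields the constant 2|M| + 1.
  · have h2 : (|M| - |n|) ^ 2 ≤ (M - n) ^ 2 := sq_le_sq.2 (abs_abs_sub_abs_le_abs_sub M n)
    nlinarith [sq_nonneg (|n| - |M| - 1), le_abs_self n]
  · rw [norm_mul, Real.norm_eq_abs, abs_neg_one_zpow, one_mul,
      Real.norm_of_nonneg (zpow_pos h0 _).le]

/-- Subtracting q^(2N+2) times the N-th coefficient leaves the factor 1 - q^(2n+1) in each
numerator. The denominators cancel, and what remains is the vanishing sum of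
`tsum_neg_one_zpow_mul_zpow`. -/
theorem lambertThetaCoeff_add_one (h0 : 0 < q) (h1 : q < 1) (N : ℤ) :
    lambertThetaCoeff q (N + 1) = q ^ (2 * (N + 1)) * lambertThetaCoeff q N := by
  have hterm : ∀ n : ℤ, (-1) ^ n * lambertCoeff q n * q ^ (N + 1 - n) ^ 2 =
      q ^ (2 * (N + 1)) * ((-1) ^ n * lambertCoeff q n * q ^ (N - n) ^ 2) +
        q ^ (2 * N + 1) * ((-1) ^ n * q ^ ((N - n) ^ 2 - n)) := by
    intro n
    have h := one_sub_zpow_ne_zero h0 h1 n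
    have hq := h0.ne'
    have e1 : q ^ (N + 1 - n) ^ 2 = q ^ (2 * N + 1) * (q ^ n)⁻¹ * (q ^ n)⁻¹ * q ^ (N - n) ^ 2 := by
      rw [← zpow_neg, ← zpow_add₀ hq, ← zpow_add₀ hq, ← zpow_add₀ hq]
      congr 1
      ring
    have e2 : q ^ ((N - n) ^ 2 - n) = (q ^ n)⁻¹ * q ^ (N - n) ^ 2 := by
      rw [← zpow_neg, ← zpow_add₀ hq]
      congr 1
      ring
    have e3 : q ^ (2 * (N + 1)) = q ^ (2 * N + 1) * q := by
      rw [← zpow_add_one₀ hq]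
      congr 1
      ring
    have e4 : q ^ (2 * n + 1) = (q ^ n) ^ 2 * q := by
      rw [zpow_add_one₀ hq, mul_comm 2 n, zpow_mul, zpow_ofNat]
    have h5 : q ^ n ≠ 0 := (zpow_pos h0 _).ne'
    rw [lambertCoeff, e1, e2, e3]
    rw [e4] at h ⊢
    field_simp
    ring
  rw [lambertThetaCoeff, tsum_congr hterm, Summable.tsum_add
    ((summable_lambertThetaCoeff h0 h1 N).mul_left _)
    ((summable_neg_one_zpow_mul_zpow h0 h1 N).mul_left _), tsum_mul_left, tsum_mul_left,
    tsum_neg_one_zpow_mul_zpow, mul_zero, add_zero, lambertThetaCoeff]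

theorem lambertThetaCoeff_eq (h0 : 0 < q) (h1 : q < 1) (N : ℤ) :
    lambertThetaCoeff q N = q ^ (N ^ 2 + N) * lambertThetaCoeff q 0 := by
  induction N using Int.induction_on with
  | zero => simp
  | succ i ih =>
    rw [lambertThetaCoeff_add_one h0 h1, ih, ← mul_assoc, ← zpow_add₀ h0.ne']
    congr 2
    ring
  | pred i ih =>
    have h := lambertThetaCoeff_add_one h0 h1 (-(i : ℤ) - 1)
    rw [sub_add_cancel, ih] at h
    have h2 : q ^ (2 * -(i : ℤ)) ≠ 0 := (zpow_pos h0 _).ne'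
    apply mul_left_cancel₀ h2
    rw [← h, ← mul_assoc, ← zpow_add₀ h0.ne']
    congr 2
    ring

/-- The bilateral Lambert series `∑ (-1)ⁿ qⁿ zⁿ / (1 - q^(2n+1))`. -/
noncomputable def lambertSum (q : ℝ) (z : ℂ) : ℂ :=
  ∑' n : ℤ, (((-1) ^ n * lambertCoeff q n : ℝ) : ℂ) * z ^ n

theorem summable_norm_lambertSum (h0 : 0 < q) (h1 : q < 1) (hz : ‖z‖ = 1) :
    Summable fun n : ℤ => ‖(((-1) ^ n * lambertCoeff q n : ℝ) : ℂ) * z ^ n‖ := by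
  refine (summable_abs_lambertCoeff h0 h1).congr fun n => ?_
  rw [norm_mul, norm_zpow, hz, one_zpow, mul_one, Complex.norm_real, Real.norm_eq_abs, abs_mul,
    abs_neg_one_zpow, one_mul]

/-- Pairs of integers, reindexed by their sum and their first entry. -/
def sumFstEquiv : ℤ × ℤ ≃ ℤ × ℤ where
  toFun p := (p.2, p.1 - p.2)
  invFun p := (p.1 + p.2, p.1)
  left_inv p := by ext <;> simp
  right_inv p := by ext <;> simp

theorem lambertSum_mul_thetaSum (h0 : 0 < q) (h1 : q < 1) (hz : ‖z‖ = 1) :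
    lambertSum q z * thetaSum q z = lambertThetaCoeff q 0 * thetaHalfSum q z := by
  have hs := summable_norm_lambertSum h0 h1 hz
  have ht := summable_norm_thetaSum h0 h1 hz
  have hz0 : z ≠ 0 := by rintro rfl; simp at hz
  have hst := sumFstEquiv.summable_iff.2 (summable_mul_of_summable_norm hs ht)
  rw [lambertSum, thetaSum, tsum_mul_tsum_of_summable_norm hs ht, ← sumFstEquiv.tsum_eq]
  refine (hst.tsum_prod).trans ?_
  rw [thetaHalfSum, ← tsum_mul_left]
  refine tsum_congr fun N => ?_
  have h := lambertThetaCoeff_eq h0 h1 N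
  have h' := congrArg (fun x : ℝ => (x : ℂ) * z ^ N) h
  rw [mul_left_comm, ← mul_assoc]
  push_cast at h'
  rw [← h', lambertThetaCoeff, Complex.ofReal_tsum, ← tsum_mul_right]
  refine tsum_congr fun n => ?_
  simp only [sumFstEquiv, Equiv.coe_fn_mk, Function.comp]
  rw [zpow_sub₀ hz0]
  have : z ^ n ≠ 0 := zpow_ne_zero _ hz0
  push_cast
  field_simp

end

/-! ### Theta constants and their limits at q = 0 -/

section
variable {q : ℝ}

/-- The theta constant `θ₃ = ∑ q^(m²)`. -/
noncomputable def thetaThree (q : ℝ) : ℝ := ∑' m : ℤ, q ^ m ^ 2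

/-- The theta constant `θ₄ = ∑ (-1)^m q^(m²)`. -/
noncomputable def thetaFour (q : ℝ) : ℝ := ∑' m : ℤ, (-1) ^ m * q ^ m ^ 2

/-- The theta constant `q^(-1/4) θ₂ = ∑ q^(m² + m)`. -/
noncomputable def thetaTwoReduced (q : ℝ) : ℝ := ∑' m : ℤ, q ^ (m ^ 2 + m)

theorem thetaSum_one (q : ℝ) : thetaSum q 1 = thetaThree q := by
  rw [thetaSum, thetaThree, Complex.ofReal_tsum]
  refine tsum_congr fun m => ?_
  push_cast
  rw [one_zpow, mul_one]

theorem thetaSum_neg_one (q : ℝ) : thetaSum q (-1) = thetaFour q := by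
  rw [thetaSum, thetaFour, Complex.ofReal_tsum]
  refine tsum_congr fun m => ?_
  push_cast
  rw [mul_comm]

theorem thetaHalfSum_one (q : ℝ) : thetaHalfSum q 1 = thetaTwoReduced q := by
  rw [thetaHalfSum, thetaTwoReduced, Complex.ofReal_tsum]
  refine tsum_congr fun m => ?_
  push_cast
  rw [one_zpow, mul_one]

theorem thetaThree_sq (h0 : 0 < q) (h1 : q < 1) :
    thetaThree q ^ 2 = thetaThree (q ^ 2) ^ 2 + q * thetaTwoReduced (q ^ 2) ^ 2 := by
  have h := thetaSum_sq h0 h1 (z := 1) norm_one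
  rw [one_pow, thetaSum_one, thetaSum_one, thetaHalfSum_one] at h
  rw [← Complex.ofReal_inj]
  push_cast
  rw [h]
  ring

theorem thetaFour_sq (h0 : 0 < q) (h1 : q < 1) :
    thetaFour q ^ 2 = thetaThree (q ^ 2) ^ 2 - q * thetaTwoReduced (q ^ 2) ^ 2 := by
  have h := thetaSum_sq h0 h1 (z := -1) (by simp)
  rw [neg_one_sq, thetaSum_one, thetaSum_neg_one, thetaHalfSum_one] at h
  rw [← Complex.ofReal_inj]
  push_cast
  rw [h]
  ring

theorem thetaTwoReduced_sq (h0 : 0 < q) (h1 : q < 1) :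
    thetaTwoReduced q ^ 2 = 2 * thetaThree (q ^ 2) * thetaTwoReduced (q ^ 2) := by
  have h := thetaHalfSum_sq h0 h1 (z := 1) norm_one
  rw [one_pow, thetaSum_one, thetaHalfSum_one, thetaHalfSum_one, inv_one] at h
  rw [← Complex.ofReal_inj]
  push_cast
  rw [h]
  ring

theorem thetaThree_pos (h0 : 0 < q) (h1 : q < 1) : 0 < thetaThree q :=
  (summable_zpow_sq h0 h1).tsum_pos (fun _ => (zpow_pos h0 _).le) 0 (zpow_pos h0 _)

theorem thetaTwoReduced_pos (h0 : 0 < q) (h1 : q < 1) : 0 < thetaTwoReduced q :=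
  (summable_zpow_sq_add h0 h1).tsum_pos (fun _ => (zpow_pos h0 _).le) 0 (zpow_pos h0 _)

open Filter Topology

/-- A function invariant under `q ↦ q²` equals its limit at `0`. -/
theorem eq_of_tendsto_of_sq_invariant {f : ℝ → ℝ} {l : ℝ}
    (hf : ∀ q, 0 < q → q < 1 → f (q ^ 2) = f q) (hl : Tendsto f (𝓝[>] 0) (𝓝 l))
    (h0 : 0 < q) (h1 : q < 1) : f q = l := by
  have hq : Tendsto (fun n : ℕ => q ^ 2 ^ n) atTop (𝓝[>] 0) := by
    refine tendsto_nhdsWithin_iff.2 ⟨?_, .of_forall fun n => pow_pos h0 _⟩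
    exact (tendsto_pow_atTop_nhds_zero_of_lt_one h0.le h1).comp
      (tendsto_pow_atTop_atTop_of_one_lt one_lt_two)
  have hc : ∀ n : ℕ, f (q ^ 2 ^ n) = f q := by
    intro n
    induction n with
    | zero => simp
    | succ n ih =>
      rw [pow_succ, pow_mul, hf _ (by positivity) (pow_lt_one₀ h0.le h1 (by positivity)), ih]
  refine tendsto_nhds_unique (tendsto_const_nhds) ((hl.comp hq).congr hc)

theorem eventually_pos_and_lt_half : ∀ᶠ q : ℝ in 𝓝[>] 0, 0 < q ∧ q < 1 / 2 :=
  Ioo_mem_nhdsGT (by norm_num)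

theorem tendsto_tsum_zpow {f : ℤ → ℤ} (c : ℤ) (hf : ∀ m, |m| - c ≤ f m) (hf0 : ∀ m, 0 ≤ f m) :
    Tendsto (fun q : ℝ => ∑' m, q ^ f m) (𝓝[>] 0) (𝓝 (∑' m, if f m = 0 then 1 else 0)) := by
  refine tendsto_tsum_of_dominated_convergence
    (summable_zpow_of_abs_sub_le (q := 1 / 2) (by norm_num) (by norm_num) c hf) (fun m => ?_) ?_
  · obtain ⟨k, hk⟩ := Int.eq_ofNat_of_zero_le (hf0 m)
    simp only [hk, zpow_natCast]
    have h : Tendsto (fun q : ℝ => q ^ k) (𝓝[>] 0) (𝓝 (0 ^ k)) :=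
      ((continuous_pow k).tendsto 0).mono_left nhdsWithin_le_nhds
    convert h using 2
    rw [zero_pow_eq]
    norm_cast
  · filter_upwards [eventually_pos_and_lt_half] with q hq m
    rw [Real.norm_of_nonneg (zpow_pos hq.1 _).le]
    obtain ⟨k, hk⟩ := Int.eq_ofNat_of_zero_le (hf0 m)
    rw [hk, zpow_natCast, zpow_natCast]
    exact pow_le_pow_left₀ hq.1.le hq.2.le k

theorem tendsto_thetaThree : Tendsto thetaThree (𝓝[>] 0) (𝓝 1) := by
  have h := tendsto_tsum_zpow (f := fun m => m ^ 2) 0 (fun m => by simpa using abs_le_sq m)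
    fun m => sq_nonneg m
  rw [tsum_eq_single 0 fun m hm => if_neg (by simpa using hm), if_pos (by norm_num)] at h
  exact h

theorem tendsto_thetaTwoReduced : Tendsto thetaTwoReduced (𝓝[>] 0) (𝓝 2) := by
  have h := tendsto_tsum_zpow (f := fun m => m ^ 2 + m) 1 abs_sub_one_le_sq_add fun m => by
    rcases le_or_gt 0 m with h | h <;> nlinarith
  rw [tsum_eq_sum (s := {0, -1}) fun m hm => if_neg fun h => ?_] at h
  · norm_num at h
    exact h
  · have : m * (m + 1) = 0 := by linarith
    rcases mul_eq_zero.1 this with h | h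
    · simp [h] at hm
    · have : m = -1 := by omega
      simp [this] at hm

/-! ### The value at z = 1 and Clausen's transformation -/

/-- The alternating Lambert series `∑ (-1)ⁿ qⁿ / (1 - q^(2n+1))` over `n ≥ 0`. -/
noncomputable def altLambertSum (q : ℝ) : ℝ := ∑' n : ℕ, (-1) ^ n * lambertCoeff q n

theorem tendsto_altLambertSum : Tendsto altLambertSum (𝓝[>] 0) (𝓝 1) := by
  have h : Tendsto altLambertSum (𝓝[>] 0) (𝓝 (∑' n : ℕ, (-1) ^ n * lambertCoeff 0 n)) := by
    refine tendsto_tsum_of_dominated_convergence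
      ((summable_geometric_of_lt_one (r := (1 / 2 : ℝ)) (by norm_num) (by norm_num)).mul_right 2)
      (fun n => ?_) ?_
    · simp only [lambertCoeff_natCast]
      have hc : ContinuousAt (fun q : ℝ => (-1) ^ n * (q ^ n / (1 - q ^ (2 * n + 1)))) 0 := by
        refine ContinuousAt.mul continuousAt_const (ContinuousAt.div (by fun_prop) (by fun_prop) ?_)
        simp
      exact hc.tendsto.mono_left nhdsWithin_le_nhds
    · filter_upwards [eventually_pos_and_lt_half] with q hq n
      have hq1 : q < 1 := by linarith [hq.2]
      rw [norm_mul, norm_pow, norm_neg, norm_one, one_pow, one_mul,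
        Real.norm_of_nonneg (lambertCoeff_natCast_pos hq.1 hq1 n).le]
      refine (lambertCoeff_natCast_le hq.1 hq1 n).trans ?_
      rw [div_eq_mul_inv]
      refine mul_le_mul (pow_le_pow_left₀ hq.1.le hq.2.le n) ?_ (by rw [inv_nonneg]; linarith)
        (by positivity)
      rw [inv_le_comm₀ (by linarith) (by norm_num)]
      linarith [hq.2]
  rw [tsum_eq_single 0 fun n hn => by rw [lambertCoeff_natCast, zero_pow hn, zero_div, mul_zero]]
    at h
  simpa [lambertCoeff] using h

theorem tsum_int_eq_tsum_nat_add {E : Type*} [NormedAddCommGroup E] [CompleteSpace E] {f : ℤ → E}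
    (hf : Summable f) : ∑' n, f n = ∑' n : ℕ, (f n + f (-(n + 1))) := by
  have hn : Summable fun n : ℕ => f n := hf.comp_injective Nat.cast_injective
  have hm : Summable fun n : ℕ => f (-(n + 1)) :=
    hf.comp_injective (i := fun n : ℕ => -((n : ℤ) + 1)) fun a b h => by simpa using h
  rw [tsum_of_nat_of_neg_add_one hn hm, hn.tsum_add hm]

theorem lambertSum_eq_tsum_nat {z : ℂ} (h0 : 0 < q) (h1 : q < 1) (hz : ‖z‖ = 1) :
    lambertSum q z =
      ∑' n : ℕ, (((-1) ^ n * lambertCoeff q n : ℝ) : ℂ) * (z ^ n + (z ^ (n + 1))⁻¹) := by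
  rw [lambertSum, tsum_int_eq_tsum_nat_add (summable_norm_lambertSum h0 h1 hz).of_norm]
  refine tsum_congr fun n => ?_
  have e1 : (-1 : ℝ) ^ (-((n : ℤ) + 1)) = -(-1) ^ n := by
    rw [zpow_neg, ← inv_zpow, zpow_add_one₀ (by norm_num)]
    norm_num
  have e2 : lambertCoeff q (-((n : ℤ) + 1)) = -lambertCoeff q n := by
    rw [← lambertCoeff_neg h0 h1]
    congr 1
    ring
  have e3 : z ^ (-((n : ℤ) + 1)) = (z ^ (n + 1))⁻¹ := by
    rw [zpow_neg]
    norm_cast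
  rw [e1, e2, e3, zpow_natCast, zpow_natCast, neg_mul_neg, mul_add]

theorem lambertSum_one (h0 : 0 < q) (h1 : q < 1) :
    lambertSum q 1 = 2 * altLambertSum q := by
  rw [lambertSum_eq_tsum_nat h0 h1 norm_one, altLambertSum, Complex.ofReal_tsum, ← tsum_mul_left]
  refine tsum_congr fun n => ?_
  norm_num
  ring

theorem lambertThetaCoeff_zero (h0 : 0 < q) (h1 : q < 1) :
    lambertThetaCoeff q 0 =
      ∑' n : ℕ, (-1) ^ n * lambertCoeff q n * (q ^ n ^ 2 * (1 + q ^ (2 * n + 1))) := by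
  rw [lambertThetaCoeff, tsum_int_eq_tsum_nat_add (summable_lambertThetaCoeff h0 h1 0)]
  refine tsum_congr fun n => ?_
  have e1 : (-1 : ℝ) ^ (-((n : ℤ) + 1)) = -(-1) ^ n := by
    rw [zpow_neg, ← inv_zpow, zpow_add_one₀ (by norm_num)]
    norm_num
  have e2 : lambertCoeff q (-((n : ℤ) + 1)) = -lambertCoeff q n := by
    rw [← lambertCoeff_neg h0 h1]
    congr 1
    ring
  have e3 : q ^ (0 - (-((n : ℤ) + 1))) ^ 2 = q ^ n ^ 2 * q ^ (2 * n + 1) := by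
    rw [← pow_add, ← zpow_natCast]
    congr 1
    push_cast
    ring
  have e4 : q ^ (0 - (n : ℤ)) ^ 2 = q ^ n ^ 2 := by
    rw [zero_sub, neg_sq, ← zpow_natCast]
    norm_cast
  rw [e1, e2, e3, e4, zpow_natCast]
  ring

/-- Pairs of natural numbers, split into the diagonal and the two strict triangles. -/
noncomputable def triangleSplit : ℕ ⊕ (ℕ × ℕ) ⊕ (ℕ × ℕ) ≃ ℕ × ℕ :=
  Equiv.ofBijective (Sum.elim (fun m => (m, m))
    (Sum.elim (fun p => (p.1 + p.2 + 1, p.1)) fun p => (p.1, p.1 + p.2 + 1))) (by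
    constructor
    · rintro (a | ⟨a, b⟩ | ⟨a, b⟩) (c | ⟨c, d⟩ | ⟨c, d⟩) h <;>
        simp only [Sum.elim_inl, Sum.elim_inr, Prod.mk.injEq, Sum.inl.injEq, Sum.inr.injEq,
          reduceCtorEq] at h ⊢ <;> omega
    · rintro ⟨m, n⟩
      rcases lt_trichotomy m n with h | h | h
      · exact ⟨Sum.inr (Sum.inr (m, n - m - 1)), by simp; omega⟩
      · exact ⟨Sum.inl m, by simp [h]⟩
      · exact ⟨Sum.inr (Sum.inl (n, m - n - 1)), by simp; omega⟩)

theorem triangleSplit_inl (m : ℕ) : triangleSplit (Sum.inl m) = (m, m) := rfl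

theorem triangleSplit_inr_inl (m j : ℕ) :
    triangleSplit (Sum.inr (Sum.inl (m, j))) = (m + j + 1, m) := rfl

theorem triangleSplit_inr_inr (m j : ℕ) :
    triangleSplit (Sum.inr (Sum.inr (m, j))) = (m, m + j + 1) := rfl

theorem tsum_eq_tsum_diagonal_add {f : ℕ × ℕ → ℝ} (hf : Summable f) :
    ∑' p, f p = ∑' m, (f (m, m) + ∑' j, (f (m + j + 1, m) + f (m, m + j + 1))) := by
  have hr := hf.comp_injective (triangleSplit.injective.comp Sum.inr_injective)
  have e := tsum_equiv_sum triangleSplit hf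
  have e' := tsum_equiv_sum (Equiv.refl ((ℕ × ℕ) ⊕ (ℕ × ℕ))) hr
  have hd := hf.comp_injective (triangleSplit.injective.comp Sum.inl_injective)
  have hu := hr.comp_injective Sum.inl_injective
  have hl := hr.comp_injective Sum.inr_injective
  simp only [Function.comp_def, Equiv.refl_apply, triangleSplit_inl] at hd hu hl e e'
  rw [e, e', ← hu.tsum_add hl, (hu.add hl).tsum_prod, ← hd.tsum_add (hu.add hl).prod]
  simp only [triangleSplit_inr_inl, triangleSplit_inr_inr]

theorem summable_clausen (h0 : 0 < q) (h1 : q < 1) :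
    Summable fun p : ℕ × ℕ => (-1 : ℝ) ^ p.1 * q ^ (2 * p.1 * p.2 + p.1 + p.2) := by
  have hg := summable_geometric_of_lt_one h0.le h1
  refine Summable.of_norm_bounded (hg.mul_of_nonneg hg (fun _ => by positivity)
    fun _ => by positivity) fun p => ?_
  rw [norm_mul, norm_pow, norm_neg, norm_one, one_pow, one_mul,
    Real.norm_of_nonneg (by positivity), ← pow_add]
  exact pow_le_pow_of_le_one h0.le h1.le (by rw [add_assoc]; exact Nat.le_add_left _ _)

/-- Expanding the geometric series gives a double series whose exponent is symmetric in the two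
indices; only the sign is not. -/
theorem tsum_clausen (h0 : 0 < q) (h1 : q < 1) :
    ∑' p : ℕ × ℕ, (-1 : ℝ) ^ p.1 * q ^ (2 * p.1 * p.2 + p.1 + p.2) = altLambertSum q := by
  rw [(summable_clausen h0 h1).tsum_prod, altLambertSum]
  refine tsum_congr fun n => ?_
  have hx : q ^ (2 * n + 1) < 1 := pow_lt_one₀ h0.le h1 (by omega)
  simp only
  rw [lambertCoeff_natCast, div_eq_mul_inv,
    ← tsum_geometric_of_lt_one (by positivity) hx, ← tsum_mul_left, ← tsum_mul_left]
  refine tsum_congr fun m => ?_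
  rw [← pow_mul, ← pow_add]
  congr 2
  ring

theorem tsum_geometric_sub_alternating {x : ℝ} (h0 : 0 < x) (h1 : x < 1) :
    ∑' j : ℕ, (1 - (-1) ^ j) * x ^ (j + 1) = 2 * x ^ 2 / (1 - x ^ 2) := by
  have ha := (hasSum_geometric_of_lt_one h0.le h1).mul_left x
  have hb := (hasSum_geometric_of_abs_lt_one (r := -x)
    (by rwa [abs_neg, abs_of_pos h0])).mul_left x
  have h := (ha.sub hb).tsum_eq
  have h2 : (1 - x) ≠ 0 := by linarith
  have h3 : (1 + x) ≠ 0 := by linarith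
  have h4 : (1 - x ^ 2) ≠ 0 := by nlinarith
  have e : x * (1 - x)⁻¹ - x * (1 - -x)⁻¹ = 2 * x ^ 2 / (1 - x ^ 2) := by
    rw [sub_neg_eq_add]
    have : 1 - x ^ 2 = (1 - x) * (1 + x) := by ring
    rw [this]
    field_simp
    ring
  rw [← e, ← h]
  refine tsum_congr fun j => ?_
  rw [neg_pow]
  ring

/-- Clausen's transformation of the Lambert series. -/
theorem lambertThetaCoeff_sq_zero (h0 : 0 < q) (h1 : q < 1) :
    lambertThetaCoeff (q ^ 2) 0 = altLambertSum q := by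
  rw [lambertThetaCoeff_zero (by positivity) (by nlinarith), ← tsum_clausen h0 h1,
    tsum_eq_tsum_diagonal_add (summable_clausen h0 h1)]
  refine tsum_congr fun m => ?_
  have hx0 : 0 < q ^ (2 * m + 1) := pow_pos h0 _
  have hx : q ^ (2 * m + 1) < 1 := pow_lt_one₀ h0.le h1 (by omega)
  -- Mirror-image terms of the two triangles have equal exponents, so their signs combine to (-1)^m
  -- (1 - (-1)^j); the sum over j is then geometric in q^(2m+1).
  have hj : ∀ j : ℕ, (-1 : ℝ) ^ (m + j + 1) * q ^ (2 * (m + j + 1) * m + (m + j + 1) + m) +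
      (-1) ^ m * q ^ (2 * m * (m + j + 1) + m + (m + j + 1)) =
      (-1) ^ m * q ^ (2 * m * m + m + m) * ((1 - (-1) ^ j) * (q ^ (2 * m + 1)) ^ (j + 1)) := by
    intro j
    rw [← pow_mul]
    have e1 : q ^ (2 * (m + j + 1) * m + (m + j + 1) + m) =
        q ^ (2 * m * m + m + m) * q ^ ((2 * m + 1) * (j + 1)) := by
      rw [← pow_add]
      congr 1
      ring
    have e2 : q ^ (2 * m * (m + j + 1) + m + (m + j + 1)) =
        q ^ (2 * m * m + m + m) * q ^ ((2 * m + 1) * (j + 1)) := by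
      rw [← pow_add]
      congr 1
      ring
    rw [e1, e2]
    ring
  simp only [hj]
  rw [tsum_mul_left, tsum_geometric_sub_alternating hx0 hx, lambertCoeff_natCast]
  have e1 : (q ^ 2) ^ (2 * m + 1) = (q ^ (2 * m + 1)) ^ 2 := by rw [← pow_mul, ← pow_mul, mul_comm]
  have e2 : q ^ (2 * m * m + m + m) = (q ^ 2) ^ m * (q ^ 2) ^ m ^ 2 := by
    rw [← pow_mul, ← pow_mul, ← pow_add]
    congr 1
    ring
  have h4 : (1 - (q ^ (2 * m + 1)) ^ 2) ≠ 0 := by nlinarith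
  rw [e1, e2]
  field_simp
  ring

/-- The case z = 1, Clausen's transformation and ϑ₂(q)² = 2θ₃(q²)ϑ₂(q²) show that c/(θ₃ϑ₂) is
invariant under q ↦ q²; its value is the limit 1/2 at q = 0. -/
theorem lambertThetaCoeff_zero_eq (h0 : 0 < q) (h1 : q < 1) :
    lambertThetaCoeff q 0 = thetaThree q * thetaTwoReduced q / 2 := by
  have key : ∀ q : ℝ, 0 < q → q < 1 → 2 * altLambertSum q * thetaThree q =
      lambertThetaCoeff q 0 * thetaTwoReduced q := by
    intro q h0 h1
    have h := lambertSum_mul_thetaSum h0 h1 (z := 1) norm_one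
    rw [lambertSum_one h0 h1, thetaSum_one, thetaHalfSum_one] at h
    exact_mod_cast h
  have hinv : ∀ q : ℝ, 0 < q → q < 1 →
      lambertThetaCoeff (q ^ 2) 0 / (thetaThree (q ^ 2) * thetaTwoReduced (q ^ 2)) =
        lambertThetaCoeff q 0 / (thetaThree q * thetaTwoReduced q) := by
    intro q h0 h1
    have h2 := key q h0 h1
    rw [← lambertThetaCoeff_sq_zero h0 h1] at h2
    have h3 := thetaTwoReduced_sq h0 h1
    have p1 := thetaThree_pos h0 h1
    have p2 := thetaTwoReduced_pos h0 h1
    have p3 := thetaThree_pos (q := q ^ 2) (by positivity) (by nlinarith)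
    have p4 := thetaTwoReduced_pos (q := q ^ 2) (by positivity) (by nlinarith)
    rw [div_eq_div_iff (by positivity) (by positivity)]
    linear_combination thetaTwoReduced q / 2 * h2 + lambertThetaCoeff q 0 / 2 * h3
  have hsq : Tendsto (fun q : ℝ => q ^ 2) (𝓝[>] 0) (𝓝[>] 0) := by
    refine tendsto_nhdsWithin_iff.2 ⟨?_, ?_⟩
    · have := ((continuous_pow 2).tendsto (0 : ℝ)).mono_left (nhdsWithin_le_nhds (s := Set.Ioi 0))
      simpa using this
    · filter_upwards [self_mem_nhdsWithin] with q hq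
      exact pow_pos (Set.mem_Ioi.1 hq) 2
  have hlim : Tendsto (fun q => lambertThetaCoeff (q ^ 2) 0 /
      (thetaThree (q ^ 2) * thetaTwoReduced (q ^ 2))) (𝓝[>] 0) (𝓝 (1 / (1 * 2))) := by
    refine Tendsto.congr' ?_ (tendsto_altLambertSum.div ((tendsto_thetaThree.comp hsq).mul
      (tendsto_thetaTwoReduced.comp hsq)) (by norm_num))
    filter_upwards [eventually_pos_and_lt_half] with q hq
    rw [lambertThetaCoeff_sq_zero hq.1 (by linarith [hq.2])]
    rfl
  -- Clausen's transformation gives c at q², so the limit is taken for the quotient at q²; one more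
  -- use of `hinv` returns to q.
  have h := eq_of_tendsto_of_sq_invariant
    (fun q h0 h1 => hinv (q ^ 2) (by positivity) (by nlinarith)) hlim h0 h1
  rw [hinv q h0 h1] at h
  have p1 := thetaThree_pos h0 h1
  have p2 := thetaTwoReduced_pos h0 h1
  rw [div_eq_iff (by positivity)] at h
  rw [h]
  ring

end

/-! ### The value at z = i, up to sign -/

section
variable {q : ℝ}
open Filter Topology

/-- The terms n and -n - 1 pair up, and (-1)ⁿ(iⁿ + i^(-n-1)) = (-1)^⌊n/2⌋(1 - i). -/
theorem lambertSum_I (h0 : 0 < q) (h1 : q < 1) :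
    lambertSum q Complex.I =
      (1 - Complex.I) * (∑' n : ℕ, (-1) ^ (n / 2) * lambertCoeff q n : ℝ) := by
  rw [lambertSum_eq_tsum_nat h0 h1 Complex.norm_I, Complex.ofReal_tsum, ← tsum_mul_left]
  refine tsum_congr fun n => ?_
  have hI := Complex.I_sq
  rcases Nat.even_or_odd' n with ⟨k, rfl | rfl⟩
  · have e : 2 * k / 2 = k := by omega
    rw [e, pow_succ, pow_mul, pow_mul, hI, mul_inv, Complex.inv_I, ← inv_pow]
    push_cast
    norm_num
    ring
  · have e : (2 * k + 1) / 2 = k := by omega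
    rw [e, show 2 * k + 1 + 1 = 2 * (k + 1) by ring, pow_succ, pow_succ, pow_mul, pow_mul, pow_mul,
      hI, ← inv_pow]
    push_cast
    norm_num [pow_succ]
    ring

theorem summable_neg_one_pow_mul {a : ℕ → ℝ} (ha : Summable fun n => |a n|) (e : ℕ → ℕ) :
    Summable fun n => (-1) ^ e n * a n := by
  refine Summable.of_norm_bounded ha fun n => ?_
  rw [norm_mul, norm_pow, norm_neg, norm_one, one_pow, one_mul, Real.norm_eq_abs]

theorem lambertCoeff_natCast_antitone (h0 : 0 < q) (h1 : q < 1) :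
    Antitone fun n : ℕ => lambertCoeff q n := by
  intro m n hmn
  simp only [lambertCoeff_natCast]
  have h2 : q ^ (2 * m + 1) < 1 := pow_lt_one₀ h0.le h1 (by omega)
  have h3 : q ^ n ≤ q ^ m := pow_le_pow_of_le_one h0.le h1.le hmn
  have h4 : q ^ (2 * n + 1) ≤ q ^ (2 * m + 1) := pow_le_pow_of_le_one h0.le h1.le (by omega)
  exact div_le_div₀ (by positivity) h3 (by linarith) (by linarith)

theorem hasSum_even_add_odd {b : ℕ → ℝ} (hb : Summable b) :
    HasSum (fun k => b (2 * k) + b (2 * k + 1)) (∑' n, b n) := by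
  have he : Summable fun k => b (2 * k) := hb.comp_injective (mul_right_injective₀ two_ne_zero)
  have ho : Summable fun k => b (2 * k + 1) :=
    hb.comp_injective ((add_left_injective 1).comp (mul_right_injective₀ two_ne_zero))
  rw [← tsum_even_add_odd he ho]
  exact he.hasSum.add ho.hasSum

/-- Grouping consecutive terms in pairs gives an ordinary alternating series. This fixes the sign of
S, which the theta identity determines only up to squares. -/
theorem tsum_neg_one_pow_half_mul_nonneg {a : ℕ → ℝ} (hs : Summable fun n => |a n|)
    (ha : Antitone a) : 0 ≤ ∑' n : ℕ, (-1) ^ (n / 2) * a n := by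
  have hsum := hasSum_even_add_odd (summable_neg_one_pow_mul hs fun n => n / 2)
  have e : ∀ k : ℕ, (-1) ^ (2 * k / 2) * a (2 * k) + (-1) ^ ((2 * k + 1) / 2) * a (2 * k + 1) =
      (-1) ^ k * (a (2 * k) + a (2 * k + 1)) := by
    intro k
    rw [show 2 * k / 2 = k by omega, show (2 * k + 1) / 2 = k by omega]
    ring
  simp only [e] at hsum
  have hanti : Antitone fun k => a (2 * k) + a (2 * k + 1) := fun m n hmn =>
    add_le_add (ha (by omega)) (ha (by omega))
  simpa using hanti.alternating_series_le_tendsto hsum.tendsto_sum_nat 0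

/-! ### Poisson summation for θ₃ and θ₄ -/

theorem exp_zpow (x : ℝ) (n : ℤ) : Real.exp x ^ n = Real.exp (n * x) := by
  rw [← Real.rpow_intCast, ← Real.exp_mul, mul_comm]

theorem thetaFour_exp {s : ℝ} (hs : 0 < s) :
    thetaFour (Real.exp (-(Real.pi * s))) = (Real.sqrt s)⁻¹ *
      (Real.exp (-(Real.pi / (4 * s))) * thetaTwoReduced (Real.exp (-(Real.pi / s)))) := by
  -- The linear parameter i/2 produces (-1)ⁿ on one side and a shift by -1/2 on the other; after n ↦
  -- -n, (n + 1/2)² = n² + n + 1/4.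
  have h := Complex.tsum_exp_neg_quadratic (a := s) (by simpa using hs) (Complex.I / 2)
  have hl : ∑' n : ℤ, Complex.exp (-Real.pi * s * n ^ 2 + 2 * Real.pi * (Complex.I / 2) * n) =
      thetaFour (Real.exp (-(Real.pi * s))) := by
    rw [thetaFour, Complex.ofReal_tsum]
    refine tsum_congr fun n => ?_
    rw [Complex.exp_add, exp_zpow]
    have e : Complex.exp (2 * Real.pi * (Complex.I / 2) * n) = (-1) ^ n := by
      rw [← Complex.exp_pi_mul_I, ← Complex.exp_int_mul]
      congr 1
      ring
    rw [e]
    push_cast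
    rw [mul_comm]
    congr 2
    ring
  have hr : ∑' n : ℤ, Complex.exp (-Real.pi / s * (n + Complex.I * (Complex.I / 2)) ^ 2) =
      ((Real.exp (-(Real.pi / (4 * s))) * thetaTwoReduced (Real.exp (-(Real.pi / s))) : ℝ) : ℂ) := by
    rw [thetaTwoReduced, ← tsum_mul_left, Complex.ofReal_tsum, ← (Equiv.neg ℤ).tsum_eq]
    refine tsum_congr fun n => ?_
    rw [exp_zpow, ← Real.exp_add]
    push_cast
    congr 1
    have hs' : (s : ℂ) ≠ 0 := by exact_mod_cast hs.ne'
    have : Complex.I * (Complex.I / 2) = -(1 / 2) := by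
      rw [← mul_div_assoc, Complex.I_mul_I]
      ring
    rw [this]
    simp only [Equiv.neg_apply]
    push_cast
    field_simp
    ring
  rw [hl, hr] at h
  have hsq : ((s : ℂ) ^ (1 / 2 : ℂ)) = (Real.sqrt s : ℂ) := by
    rw [Real.sqrt_eq_rpow, Complex.ofReal_cpow hs.le]
    push_cast
    rfl
  rw [hsq] at h
  rw [← Complex.ofReal_inj, h]
  push_cast
  rw [one_div]

theorem thetaThree_exp {s : ℝ} (hs : 0 < s) :
    thetaThree (Real.exp (-(Real.pi * s))) =
      (Real.sqrt s)⁻¹ * thetaThree (Real.exp (-(Real.pi / s))) := by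
  have h := Real.tsum_exp_neg_mul_int_sq hs
  rw [← Real.sqrt_eq_rpow, one_div] at h
  have e : ∀ x : ℝ, thetaThree (Real.exp (-x)) = ∑' n : ℤ, Real.exp (-x * (n : ℝ) ^ 2) := by
    intro x
    refine tsum_congr fun n => ?_
    rw [exp_zpow]
    push_cast
    rw [mul_comm]
  rw [e, e]
  simpa only [neg_mul, neg_div] using h

theorem exists_eq_exp_neg_pi_mul (h0 : 0 < q) (h1 : q < 1) :
    ∃ s, 0 < s ∧ q = Real.exp (-(Real.pi * s)) := by
  refine ⟨-Real.log q / Real.pi, div_pos (neg_pos.2 (Real.log_neg h0 h1)) Real.pi_pos, ?_⟩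
  rw [mul_div_cancel₀ _ Real.pi_pos.ne', neg_neg, Real.exp_log h0]

/-- The series alternates, but its Poisson dual has positive terms. -/
theorem thetaFour_pos (h0 : 0 < q) (h1 : q < 1) : 0 < thetaFour q := by
  obtain ⟨s, hs, rfl⟩ := exists_eq_exp_neg_pi_mul h0 h1
  rw [thetaFour_exp hs]
  have := thetaTwoReduced_pos (q := Real.exp (-(Real.pi / s))) (Real.exp_pos _)
    (Real.exp_lt_one_iff.2 (neg_neg_of_pos (div_pos Real.pi_pos hs)))
  positivity

/-- At z = i one has z² = -1, where `thetaHalfSum` vanishes, so the squares of both theta series are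
multiples of θ₄(q²). This common factor cancels from the squared product identity, leaving S², and S
≥ 0 selects the root. -/
theorem tsum_neg_one_pow_half_mul_lambertCoeff (h0 : 0 < q) (h1 : q < 1) :
    ∑' n : ℕ, (-1) ^ (n / 2) * lambertCoeff q n =
      thetaThree q * thetaTwoReduced (q ^ 2) / 2 := by
  have h0' : 0 < q ^ 2 := by positivity
  have h1' : q ^ 2 < 1 := by nlinarith
  set S := ∑' n : ℕ, (-1) ^ (n / 2) * lambertCoeff q n with hS
  have hS0 : 0 ≤ S := tsum_neg_one_pow_half_mul_nonneg (summable_lambertCoeff_natCast h0 h1).abs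
    (lambertCoeff_natCast_antitone h0 h1)
  have h := lambertSum_mul_thetaSum h0 h1 (z := Complex.I) Complex.norm_I
  have hp := thetaSum_sq h0 h1 (z := Complex.I) Complex.norm_I
  have hh := thetaHalfSum_sq h0 h1 (z := Complex.I) Complex.norm_I
  rw [Complex.I_sq, thetaHalfSum_neg_one, thetaSum_neg_one, thetaSum_one] at hp
  rw [Complex.I_sq, thetaHalfSum_neg_one, thetaSum_neg_one, thetaHalfSum_one, Complex.inv_I] at hh
  rw [lambertSum_I h0 h1] at h
  have h4 := thetaFour_pos h0' h1'
  have h3 := thetaThree_pos h0' h1'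
  have h2 := thetaTwoReduced_pos h0' h1'
  have h5 := thetaThree_pos h0 h1
  have key : 2 * S ^ 2 * thetaThree (q ^ 2) =
      lambertThetaCoeff q 0 ^ 2 * thetaTwoReduced (q ^ 2) := by
    have hne : -Complex.I * (thetaFour (q ^ 2) : ℂ) ≠ 0 :=
      mul_ne_zero (neg_ne_zero.2 Complex.I_ne_zero) (by exact_mod_cast h4.ne')
    rw [← Complex.ofReal_inj]
    push_cast
    apply mul_left_cancel₀ hne
    have hsq := congrArg (fun x => x ^ 2) h
    simp only [mul_pow, hp, hh] at hsq
    have hI : (1 - Complex.I) ^ 2 = -2 * Complex.I := by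
      rw [sub_sq, Complex.I_sq]
      ring
    rw [hI] at hsq
    linear_combination hsq
  rw [lambertThetaCoeff_zero_eq h0 h1, div_pow, mul_pow, thetaTwoReduced_sq h0 h1] at key
  have hsq : S ^ 2 = (thetaThree q * thetaTwoReduced (q ^ 2) / 2) ^ 2 := by
    apply mul_left_cancel₀ (mul_pos two_pos h3).ne'
    linear_combination key
  exact (pow_left_inj₀ hS0 (by positivity) two_ne_zero).1 hsq

/-! ### The modulus as a theta quotient and Jacobi's inversion -/

/-- The squared modulus `k² = θ₂⁴ / θ₃⁴` as a function of the nome. -/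
noncomputable def modulusSq (q : ℝ) : ℝ := q * thetaTwoReduced q ^ 4 / thetaThree q ^ 4

theorem modulusSq_nonneg (h0 : 0 < q) : 0 ≤ modulusSq q := by
  unfold modulusSq
  positivity

theorem thetaFour_pow_four (h0 : 0 < q) (h1 : q < 1) :
    thetaFour q ^ 4 = thetaThree q ^ 4 - q * thetaTwoReduced q ^ 4 := by
  have h3 := thetaThree_sq h0 h1
  have h4 := thetaFour_sq h0 h1
  have h2 := thetaTwoReduced_sq h0 h1
  have e : ∀ x : ℝ, x ^ 4 = (x ^ 2) ^ 2 := fun x => by ring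
  rw [e, e (thetaThree q), e (thetaTwoReduced q), h2, h3, h4]
  ring

theorem one_sub_modulusSq (h0 : 0 < q) (h1 : q < 1) :
    1 - modulusSq q = thetaFour q ^ 4 / thetaThree q ^ 4 := by
  have := (thetaThree_pos h0 h1).ne'
  rw [thetaFour_pow_four h0 h1, modulusSq]
  field_simp

theorem modulusSq_lt_one (h0 : 0 < q) (h1 : q < 1) : modulusSq q < 1 := by
  have h3 := thetaThree_pos h0 h1
  have h4 := thetaFour_pos h0 h1
  have h : 0 < 1 - modulusSq q := by
    rw [one_sub_modulusSq h0 h1]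
    positivity
  linarith

theorem tendsto_modulusSq : Tendsto modulusSq (𝓝[>] 0) (𝓝 0) := by
  have h := ((tendsto_id.mono_left (nhdsWithin_le_nhds (a := (0 : ℝ)) (s := Set.Ioi 0))).mul
    (tendsto_thetaTwoReduced.pow 4)).div (tendsto_thetaThree.pow 4) (by norm_num)
  simp only [zero_mul, zero_div] at h
  exact h

open EllipticAux in
/-- Jacobi's inversion: `K = (π / 2) θ₃²`. -/
theorem F_modulusSq (h0 : 0 < q) (h1 : q < 1) : F (modulusSq q) = thetaThree q ^ 2 := by
  have hinv : ∀ q : ℝ, 0 < q → q < 1 →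
      F (modulusSq (q ^ 2)) / thetaThree (q ^ 2) ^ 2 = F (modulusSq q) / thetaThree q ^ 2 := by
    intro q h0 h1
    have h0' : 0 < q ^ 2 := by positivity
    have h1' : q ^ 2 < 1 := by nlinarith
    have p3 := thetaThree_pos h0 h1
    have p4 := thetaFour_pos h0 h1
    have p3' := thetaThree_pos h0' h1'
    have p2' := thetaTwoReduced_pos h0' h1'
    have e3 := thetaThree_sq h0 h1
    have e4 := thetaFour_sq h0 h1
    have e2 := thetaTwoReduced_sq h0 h1
    -- x is the modulus at q². Landen's transformation carries x² to the squared modulus at q, with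
    -- 1 + x = θ₃(q)²/θ₃(q²)²; the condition x < 1 amounts to θ₄(q)² > 0.
    obtain ⟨x, hx⟩ : ∃ x, x = q * thetaTwoReduced (q ^ 2) ^ 2 / thetaThree (q ^ 2) ^ 2 := ⟨_, rfl⟩
    have hx0 : 0 ≤ x := by rw [hx]; positivity
    have hx1 : x < 1 := by
      rw [hx, div_lt_one (by positivity)]
      nlinarith [pow_pos p4 2]
    have hx2 : x ^ 2 = modulusSq (q ^ 2) := by
      rw [hx, modulusSq]
      ring
    have hxa : 1 + x = thetaThree q ^ 2 / thetaThree (q ^ 2) ^ 2 := by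
      rw [hx, e3]
      field_simp
    have hxq : 4 * x / (1 + x) ^ 2 = modulusSq q := by
      rw [hxa, hx, modulusSq]
      have : thetaTwoReduced q ^ 4 = (2 * thetaThree (q ^ 2) * thetaTwoReduced (q ^ 2)) ^ 2 := by
        rw [← e2]
        ring
      rw [this]
      field_simp
      ring
    have h := F_landen hx0 hx1
    rw [hxq, hx2, hxa] at h
    rw [h]
    field_simp
  have hF : Tendsto (fun q => F (modulusSq q)) (𝓝[>] 0) (𝓝 (F 0)) := by
    refine (continuousOn_F 0 ⟨le_rfl, one_pos⟩).tendsto.comp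
      (tendsto_nhdsWithin_iff.2 ⟨tendsto_modulusSq, ?_⟩)
    filter_upwards [eventually_pos_and_lt_half] with q hq
    exact ⟨modulusSq_nonneg hq.1, modulusSq_lt_one hq.1 (by linarith [hq.2])⟩
  have hF0 : F 0 = 1 := by
    refine (hasSum_F le_rfl one_pos).unique ?_
    have := hasSum_single (f := fun n => coeff n * (0 : ℝ) ^ n) 0 fun n hn => by simp [hn]
    simpa [coeff, ordinaryHypergeometricCoefficient] using this
  have h := eq_of_tendsto_of_sq_invariant hinv
    (hF.div (tendsto_thetaThree.pow 2) (by norm_num)) h0 h1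
  rw [hF0, one_pow, div_one, Pi.div_apply, div_eq_one_iff_eq (pow_pos (thetaThree_pos h0 h1) 2).ne'] at h
  exact h

end

/-! ### Identification of the singular modulus -/

section
variable {q : ℝ}

theorem modulusSq_exp_eq {s : ℝ} (hs : 0 < s) :
    1 - modulusSq (Real.exp (-(Real.pi * s))) = modulusSq (Real.exp (-(Real.pi / s))) := by
  have h1 : Real.exp (-(Real.pi * s)) < 1 :=
    Real.exp_lt_one_iff.2 (neg_neg_of_pos (mul_pos Real.pi_pos hs))
  have h2 : Real.exp (-(Real.pi / (4 * s))) ^ 4 = Real.exp (-(Real.pi / s)) := by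
    rw [← Real.exp_nat_mul]
    congr 1
    push_cast
    field_simp
  have hs' : (Real.sqrt s)⁻¹ ^ 4 ≠ 0 := by positivity
  rw [one_sub_modulusSq (Real.exp_pos _) h1, thetaFour_exp hs, thetaThree_exp hs, mul_pow, mul_pow,
    mul_pow, h2, mul_div_mul_left _ _ hs', modulusSq]

theorem ellipticK_sqrt {x : ℝ} (hx : 0 ≤ x) :
    ellipticK (Real.sqrt x) = Real.pi / 2 * EllipticAux.F x := by
  rw [ellipticK, Real.sq_sqrt hx, EllipticAux.F]

/-- By uniqueness it suffices to verify the defining equation. The complementary modulus belongs to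
the dual nome e^(-π/√r), so the ratio of the K's is a ratio of θ₃², which Poisson summation
evaluates as √r. -/
theorem singularModulus_eq {r : ℝ} (hr : 0 < r) :
    singularModulus r = Real.sqrt (modulusSq (nome r)) := by
  have hs : 0 < Real.sqrt r := Real.sqrt_pos.2 hr
  have hq1 : nome r < 1 := Real.exp_lt_one_iff.2 (neg_neg_of_pos (mul_pos Real.pi_pos hs))
  have hq0 : 0 < nome r := Real.exp_pos _
  have h3 := thetaThree_pos hq0 hq1
  have h2 := thetaTwoReduced_pos hq0 hq1
  have hm0 : 0 < modulusSq (nome r) := by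
    unfold modulusSq
    positivity
  have hm1 := modulusSq_lt_one hq0 hq1
  refine (existsUnique_isSingularModulus hr).unique (isSingularModulus_singularModulus hr)
    ⟨Real.sqrt_pos.2 hm0, by rw [Real.sqrt_lt' one_pos]; simpa using hm1, ?_⟩
  have hd0 : 0 < Real.exp (-(Real.pi / Real.sqrt r)) := Real.exp_pos _
  have hd1 : Real.exp (-(Real.pi / Real.sqrt r)) < 1 :=
    Real.exp_lt_one_iff.2 (neg_neg_of_pos (div_pos Real.pi_pos hs))
  rw [EllipticAux.ratio_eq (Real.sqrt_nonneg _) (Real.sqrt_le_one.2 hm1.le), Real.sq_sqrt hm0.le,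
    F_modulusSq hq0 hq1, nome, modulusSq_exp_eq hs, F_modulusSq hd0 hd1, thetaThree_exp hs, mul_pow,
    inv_pow, Real.sq_sqrt hs.le]
  have hd := (thetaThree_pos hd0 hd1).ne'
  field_simp

/-! ### The character, the residue class 1 mod 4 and the cosines -/

theorem rpow_natCast_add_half (h0 : 0 < q) (n : ℕ) :
    q ^ ((n : ℝ) + 1 / 2) = Real.sqrt q * q ^ n := by
  rw [Real.rpow_add h0, Real.rpow_natCast, ← Real.sqrt_eq_rpow, mul_comm]

/-- The cube comes from 8 = 2³. -/
theorem chi_eq_chi_eight_pow (n : ℕ) : chi n = ZMod.χ₈ (((n : ℤ) + 2 : ℤ) : ZMod 8) ^ 3 := by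
  have h : Nat.primeFactorsList 8 = [2, 2, 2] := Nat.prime_two.primeFactorsList_pow 3
  simp only [chi, kroneckerSymbol, h, List.map_cons, List.map_nil, if_true, List.prod_cons,
    List.prod_nil]
  ring

theorem chi_two_mul (k : ℕ) : chi (2 * k) = 0 := by
  rw [chi_eq_chi_eight_pow]
  have h : ∀ x : ZMod 8, ZMod.χ₈ (2 * x + 2) ^ 3 = 0 := by decide
  have := h k
  push_cast
  exact this

theorem chi_two_mul_add_one (k : ℕ) : chi (2 * k + 1) = -(-1) ^ (k / 2) := by
  obtain ⟨j, i, hi, rfl⟩ : ∃ j i, i < 4 ∧ k = 4 * j + i :=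
    ⟨k / 4, k % 4, Nat.mod_lt _ (by norm_num), (Nat.div_add_mod k 4).symm⟩
  have e : (4 * j + i) / 2 = 2 * j + i / 2 := by omega
  have h8 : (8 : ZMod 8) = 0 := by decide
  have e2 : ((((2 * (4 * j + i) + 1 : ℕ) : ℤ) + 2 : ℤ) : ZMod 8) = 2 * (i : ZMod 8) + 3 := by
    push_cast
    linear_combination (j : ZMod 8) * h8
  rw [chi_eq_chi_eight_pow, e, e2, pow_add, pow_mul]
  interval_cases i <;> simp <;> decide

theorem hasSum_chi {S : ℝ} (h0 : 0 < q)
    (hS : HasSum (fun n : ℕ => (-1) ^ (n / 2) * lambertCoeff q n) S) :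
    HasSum (fun n : ℕ+ => (chi (n : ℕ) : ℝ) * (q ^ (((n : ℕ) : ℝ) / 2) / (1 - q ^ (n : ℕ))))
      (-(Real.sqrt q * S)) := by
  have hinj : Function.Injective fun k : ℕ => Nat.succPNat (2 * k) :=
    Nat.succPNat_injective.comp (mul_right_injective₀ two_ne_zero)
  refine (hinj.hasSum_iff ?_).1 ?_
  · rintro n hn
    rcases Nat.even_or_odd' (n : ℕ) with ⟨k, hk | hk⟩
    · rw [hk, chi_two_mul, Int.cast_zero, zero_mul]
    · exact absurd ⟨k, PNat.eq hk.symm⟩ hn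
  · rw [← neg_mul]
    refine (hS.mul_left (-Real.sqrt q)).congr_fun fun k => ?_
    simp only [Function.comp_apply, Nat.succPNat_coe, Nat.succ_eq_add_one]
    have e : ((2 * k + 1 : ℕ) : ℝ) / 2 = (k : ℝ) + 1 / 2 := by
      push_cast
      ring
    rw [chi_two_mul_add_one, e, rpow_natCast_add_half h0, lambertCoeff_natCast]
    push_cast
    ring

/-- The `j`-th natural number congruent to `1` modulo `4`. -/
def oneModFourEquiv : ℕ ≃ {n : ℕ // n ≡ 1 [MOD 4]} where
  toFun j := ⟨4 * j + 1, by simp [Nat.ModEq]⟩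
  invFun n := (n : ℕ) / 4
  left_inv j := by
    simp only
    omega
  right_inv n := by
    have := n.2
    simp only [Nat.ModEq] at this
    ext
    simp only
    omega

theorem hasSum_one_mod_four {A : ℝ} (h0 : 0 < q)
    (hA : HasSum (fun j : ℕ => (-1) ^ j * lambertCoeff q (2 * j : ℕ)) A) :
    HasSum (fun n : {n : ℕ // n ≡ 1 [MOD 4]} =>
      (-1 : ℝ) ^ (((n : ℕ) - 1) / 4) * q ^ (((n : ℕ) : ℝ) / 2) / (1 - q ^ (n : ℕ)))
      (Real.sqrt q * A) := by
  refine oneModFourEquiv.hasSum_iff.1 ((hA.mul_left (Real.sqrt q)).congr_fun fun j => ?_)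
  have e : ((4 * j + 1 : ℕ) : ℝ) / 2 = ((2 * j : ℕ) : ℝ) + 1 / 2 := by
    push_cast
    ring
  have e2 : (4 * j + 1 - 1) / 4 = j := by omega
  have e3 : 2 * (2 * j) + 1 = 4 * j + 1 := by ring
  simp only [Function.comp_apply, oneModFourEquiv, Equiv.coe_fn_mk]
  rw [e, e2, rpow_natCast_add_half h0, lambertCoeff_natCast, e3]
  ring

theorem neg_one_pow_mul_cos (n : ℕ) :
    (-1) ^ n * Real.cos ((2 * (n : ℝ) + 3) * (Real.pi / 4)) =
      Real.sqrt 2 / 2 * (-(-1) ^ n * (-1) ^ (n / 2)) := by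
  obtain ⟨j, i, hi, rfl⟩ : ∃ j i, i < 4 ∧ n = 4 * j + i :=
    ⟨n / 4, n % 4, Nat.mod_lt _ (by norm_num), (Nat.div_add_mod n 4).symm⟩
  have e : (4 * j + i) / 2 = 2 * j + i / 2 := by omega
  have e2 : (2 * ((4 * j + i : ℕ) : ℝ) + 3) * (Real.pi / 4) =
      (2 * (i : ℝ) + 3) * (Real.pi / 4) + j * (2 * Real.pi) := by
    push_cast
    ring
  have e3 : (-1 : ℝ) ^ (4 * j + i) = (-1) ^ i := by
    rw [pow_add, pow_mul]
    norm_num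
  have e4 : (-1 : ℝ) ^ (2 * j + i / 2) = (-1) ^ (i / 2) := by
    rw [pow_add, pow_mul]
    norm_num
  rw [e, e2, e3, e4, Real.cos_add_nat_mul_two_pi]
  have c1 : Real.cos (Real.pi - Real.pi / 4) = -(Real.sqrt 2 / 2) := by
    rw [Real.cos_pi_sub, Real.cos_pi_div_four]
  have c2 : Real.cos (Real.pi / 4 + Real.pi) = -(Real.sqrt 2 / 2) := by
    rw [Real.cos_add_pi, Real.cos_pi_div_four]
  have c3 : Real.cos (2 * Real.pi - Real.pi / 4) = Real.sqrt 2 / 2 := by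
    rw [Real.cos_two_pi_sub, Real.cos_pi_div_four]
  have c4 : Real.cos (Real.pi / 4 + 2 * Real.pi) = Real.sqrt 2 / 2 := by
    rw [Real.cos_add_two_pi, Real.cos_pi_div_four]
  interval_cases i
  · rw [show (2 * ((0 : ℕ) : ℝ) + 3) * (Real.pi / 4) = Real.pi - Real.pi / 4 by push_cast; ring, c1]
    norm_num
  · rw [show (2 * ((1 : ℕ) : ℝ) + 3) * (Real.pi / 4) = Real.pi / 4 + Real.pi by push_cast; ring, c2]
    norm_num
  · rw [show (2 * ((2 : ℕ) : ℝ) + 3) * (Real.pi / 4) = 2 * Real.pi - Real.pi / 4 by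
      push_cast; ring, c3]
    norm_num
  · rw [show (2 * ((3 : ℕ) : ℝ) + 3) * (Real.pi / 4) = Real.pi / 4 + 2 * Real.pi by
      push_cast; ring, c4]
    norm_num

theorem hasSum_cdOneTerm {r A B : ℝ} (hK : ellipticK (singularModulus r) ≠ 0)
    (hA : HasSum (fun j : ℕ => (-1) ^ j * lambertCoeff (nome r) (2 * j : ℕ)) A)
    (hB : HasSum (fun j : ℕ => (-1) ^ j * lambertCoeff (nome r) (2 * j + 1 : ℕ)) B) :
    HasSum (cdOneTerm r (ellipticK (singularModulus r) / 2))
      (Real.sqrt (nome r) * (Real.sqrt 2 / 2) * (-A + B)) := by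
  have h0 : 0 < nome r := Real.exp_pos _
  -- The sign is -(-1)^j at n = 2j and (-1)^j at n = 2j + 1, so A enters negatively and B
  -- positively.
  have hAB : HasSum (fun n : ℕ => -(-1) ^ n * (-1) ^ (n / 2) * lambertCoeff (nome r) n)
      (-A + B) := by
    refine HasSum.even_add_odd (hA.neg.congr_fun fun j => ?_) (hB.congr_fun fun j => ?_)
    · rw [show 2 * j / 2 = j by omega, pow_mul]
      norm_num
    · rw [show (2 * j + 1) / 2 = j by omega, pow_succ, pow_mul]
      norm_num
  refine (hAB.mul_left _).congr_fun fun n => ?_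
  have e : (2 * (n : ℝ) + 3) * (Real.pi / (2 * ellipticK (singularModulus r))) *
      (ellipticK (singularModulus r) / 2) = (2 * (n : ℝ) + 3) * (Real.pi / 4) := by
    field_simp
    ring
  rw [cdOneTerm, e, rpow_natCast_add_half h0, lambertCoeff_natCast, mul_right_comm ((-1 : ℝ) ^ n),
    neg_one_pow_mul_cos]
  ring

end

/-! ### Assembly of the two identities -/

theorem corollary4 (r q k k' K : ℝ) (hr : 0 < r)
    (hq : q = Real.exp (-(Real.pi * Real.sqrt r)))
    (hk : k = singularModulus r) (hk' : k' = complementaryModulus k) (hK : K = ellipticK k) :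
    -- the series that defines `cd₁(q, K/2)` converges
    Summable (cdOneTerm r (K / 2)) ∧
    -- the series over `n ≡ 1 (mod 4)` converges
    Summable (fun n : {n : ℕ // n ≡ 1 [MOD 4]} =>
      (-1 : ℝ) ^ (((n : ℕ) - 1) / 4) * q ^ (((n : ℕ) : ℝ) / 2) / (1 - q ^ (n : ℕ))) ∧
    cdOne r (K / 2) =
      1 / Real.sqrt (1 + k') - Real.pi * Real.sqrt 8 / (K * k) *
        ∑' n : {n : ℕ // n ≡ 1 [MOD 4]},
          (-1 : ℝ) ^ (((n : ℕ) - 1) / 4) * q ^ (((n : ℕ) : ℝ) / 2) / (1 - q ^ (n : ℕ)) ∧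
    -- the character series converges
    Summable (fun n : ℕ+ =>
      (chi (n : ℕ) : ℝ) * (q ^ (((n : ℕ) : ℝ) / 2) / (1 - q ^ (n : ℕ)))) ∧
    -(∑' n : ℕ+, (chi (n : ℕ) : ℝ) * (q ^ (((n : ℕ) : ℝ) / 2) / (1 - q ^ (n : ℕ)))) =
      K * k / (Real.sqrt 2 * Real.pi * Real.sqrt (1 + k')) := by
  have hqr : q = nome r := hq
  have hs : 0 < Real.sqrt r := Real.sqrt_pos.2 hr
  have h0 : 0 < q := by rw [hq]; exact Real.exp_pos _
  have h1 : q < 1 := by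
    rw [hq]
    exact Real.exp_lt_one_iff.2 (neg_neg_of_pos (mul_pos Real.pi_pos hs))
  have p3 := thetaThree_pos h0 h1
  have p2 := thetaTwoReduced_pos h0 h1
  have p3' := thetaThree_pos (q := q ^ 2) (by positivity) (by nlinarith)
  have p2' := thetaTwoReduced_pos (q := q ^ 2) (by positivity) (by nlinarith)
  have pq : 0 < Real.sqrt q := Real.sqrt_pos.2 h0
  have pt : 0 < Real.sqrt 2 := Real.sqrt_pos.2 two_pos
  have hm0 := modulusSq_nonneg h0
  have hkm : k = Real.sqrt (modulusSq q) := by rw [hk, singularModulus_eq hr, hqr]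
  have hKv : K = Real.pi / 2 * thetaThree q ^ 2 := by
    rw [hK, hkm, ellipticK_sqrt hm0, F_modulusSq h0 h1]
  have hkv : k = Real.sqrt q * thetaTwoReduced q ^ 2 / thetaThree q ^ 2 := by
    rw [hkm, Real.sqrt_eq_iff_eq_sq hm0 (by positivity), div_pow, mul_pow, Real.sq_sqrt h0.le,
      modulusSq]
    ring
  have hk'v : k' = thetaFour q ^ 2 / thetaThree q ^ 2 := by
    rw [hk', complementaryModulus, hkm, Real.sq_sqrt hm0, one_sub_modulusSq h0 h1,
      Real.sqrt_eq_iff_eq_sq (by positivity) (by positivity)]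
    ring
  -- From θ₃(q)² + θ₄(q)² = 2θ₃(q²)².
  have hroot : Real.sqrt (1 + k') = Real.sqrt 2 * thetaThree (q ^ 2) / thetaThree q := by
    rw [Real.sqrt_eq_iff_eq_sq (by rw [hk'v]; positivity) (by positivity), div_pow, mul_pow,
      Real.sq_sqrt two_pos.le, hk'v, eq_div_iff (by positivity), add_mul,
      div_mul_cancel₀ _ (by positivity), one_mul, thetaThree_sq h0 h1, thetaFour_sq h0 h1]
    ring
  have hKk : K * k = Real.pi * Real.sqrt q * thetaThree (q ^ 2) * thetaTwoReduced (q ^ 2) := by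
    rw [hKv, hkv, thetaTwoReduced_sq h0 h1]
    field_simp
  have hKpos : 0 < K := by
    rw [hKv]
    have := Real.pi_pos
    positivity
  have hc := (summable_lambertCoeff_natCast h0 h1).abs
  have hS := (summable_neg_one_pow_mul hc fun n => n / 2).hasSum
  rw [tsum_neg_one_pow_half_mul_lambertCoeff h0 h1] at hS
  obtain ⟨A, hA⟩ := summable_neg_one_pow_mul
    (a := fun j : ℕ => lambertCoeff q (2 * j : ℕ))
    (hc.comp_injective (mul_right_injective₀ two_ne_zero)) fun j => j
  obtain ⟨B, hB⟩ := summable_neg_one_pow_mul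
    (a := fun j : ℕ => lambertCoeff q (2 * j + 1 : ℕ))
    (hc.comp_injective ((add_left_injective 1).comp (mul_right_injective₀ two_ne_zero))) fun j => j
  have hAB : A + B = thetaThree q * thetaTwoReduced (q ^ 2) / 2 := by
    refine HasSum.unique (HasSum.even_add_odd (hA.congr_fun fun j => ?_)
      (hB.congr_fun fun j => ?_)) hS
    · rw [show 2 * j / 2 = j by omega]
    · rw [show (2 * j + 1) / 2 = j by omega]
  have hcd := hasSum_cdOneTerm (r := r) (by rw [← hk, ← hK]; exact hKpos.ne')
    (by rwa [← hqr]) (by rwa [← hqr])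
  rw [← hk, ← hK, ← hqr] at hcd
  have h4 := hasSum_one_mod_four h0 hA
  have hchi := hasSum_chi h0 hS
  refine ⟨hcd.summable, h4.summable, ?_, hchi.summable, ?_⟩
  · have h8 : Real.sqrt 8 = 2 * Real.sqrt 2 := by
      rw [show (8 : ℝ) = 2 ^ 2 * 2 by norm_num, Real.sqrt_mul (by norm_num),
        Real.sqrt_sq (by norm_num)]
    -- Now -A + B = S - 2A: S contributes 1/√(1 + k'), and -2A the series over n ≡ 1 (mod 4).
    have hB' : B = thetaThree q * thetaTwoReduced (q ^ 2) / 2 - A := by linarith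
    have h2 := Real.mul_self_sqrt (two_pos (α := ℝ)).le
    rw [cdOne, hcd.tsum_eq, h4.tsum_eq, ← hk, ← hK, hKk, hroot, h8, hB']
    have := Real.pi_pos
    field_simp
    rw [Real.sq_sqrt two_pos.le]
    ring
  · rw [hchi.tsum_eq, neg_neg, hKk, hroot]
    have := Real.pi_pos
    field_simp
    rw [Real.sq_sqrt two_pos.le]
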